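/- **Setting.** Let $K$ be a closed oriented tetrahedra complex: a finite set of tetrahedra $T_\mu$, with vertices numbered positively for the orientation, whose faces are glued in pairs by orientation-reversing simplicial isomorphisms, no face being glued to itself. Assume that the link of every vertex of $K$ is a torus, and let $\partial M$ be the disjoint union of the links, the boundary of the complement $M$ of a neighbourhood of the vertices, with the boundary orientation. Let $k$ be a field. For an abelian group $E$ put $E[\frac12]=E\otimes_{\mathbb Z}\mathbb Z[\frac12]$. Below $(i,j,k,l)$ always denotes an even permutation of the vertices of a tetrahedron, and then the face opposite to $l$ is denoted $ijk$. **Decorations.** Let $J^2$ be the free $\mathbb Z$-module on the oriented edges $e^\mu_{ij}$ and the faces $e^\mu_{ijk}$ of the tetrahedra, with the skew-symmetric form $\Omega^2$, orthogonal sum over the tetrahedra, defined by $$\Omega^2(e_{ij},e_{ik})=1,\qquad \Omega^2(e_{ij},e_{ijk})=-1,\qquad \Omega^2(e_{ij},e_{ilj})=1,$$ all other values being $0$ up to skew-symmetry. Let $p:J^2\to (J^2)^*$, $p(v)=\Omega^2(v,\cdot)$, let $J^*=\mathrm{Im}\,p$, and let $\Omega^*$ be the symplectic form on $J^*$ with $\Omega^*(p(v),p(w))=\Omega^2(v,w)$.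 Let $C_1^{\rm or}+C_2$ be the free $\mathbb Z$-module on the oriented edges and the faces of $K$, let $F:C_1^{\rm or}+C_2\to J^2$ send an oriented edge (resp. a face) of $K$ to the sum of all the $e^\mu_{ij}$ (resp. $e^\mu_{ijk}$) identified with it, and let $F^*$ be the dual map. The space of decorations is $k^\times\otimes(J^*\cap\mathrm{Ker}\,F^*)[\frac12]$; for a decoration $z$, seen as an element of $\mathrm{Hom}(J^2,k^\times)[\frac12]$, write $z^\mu_{ij}=z(e^\mu_{ij})$ and $z^\mu_{ijk}=z(e^\mu_{ijk})$. **Holonomy.** The link of a vertex is triangulated by the traces of the tetrahedra. A closed path $c$ without backtracking in it is a succession of turns: in the triangle given by the vertex $i$ of $T_\mu$ it turns around the corner given by the edge $ij$, to the left (from the face $ijk$ to the face $ilj$) or to the right (from $ilj$ to $ijk$). The holonomy of a turn is triangular with diagonal $(\frac1{C^*},1,C)$, where $(C^*,C)=(z^\mu_{ji},\,z^\mu_{ij})$ for a left turn and $(C^*,C)=\big((z^\mu_{ji}z^\mu_{ijk}z^\mu_{ilj})^{-1},\,(z^\mu_{ij})^{-1}\big)$ for a right turn. The elements $C^*(c),C(c)\in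 k^\times[\frac12]$ are the products of the contributions of the turns of $c$. **Coefficients.** Let $L=\{x\in\mathbb Z^3: x_1+x_2+x_3=0\}$, identified with $\mathbb Z^2$ by the basis $(1,-1,0),(0,1,-1)$, with the euclidean product, and let $\langle\,,\rangle$ be the dual scalar product on $L^*$; in the dual basis its Gram matrix is $\begin{pmatrix}2/3&1/3\\1/3&2/3\end{pmatrix}$. The Goldman–Weil–Petersson form $\mathrm{wp}$ on $H^1(\partial M,L^*)$ is the coupling of the cup product, evaluated on the fundamental class of $\partial M$, with $\langle\,,\rangle$; the form $3\,\mathrm{wp}$ is integral. For an integral bilinear form $B$ on a $\mathbb Z$-module $V$, let $\wedge_B$ be the pairing on $k^\times\otimes V[\frac12]$ with values in $(k^\times\wedge_{\mathbb Z}k^\times)[\frac12]$ given by $(x\otimes v)\wedge_B(y\otimes w)=B(v,w)\,(x\wedge y)$. Here $k^\times\wedge_{\mathbb Z}k^\times$ is generated by the bilinear symbols $x\wedge y$ with the relations $x\wedge y=-y\wedge x$. **Statement.** There is a unique homomorphism (the boundary holonomy map) $$R:\ k^\times\otimes(J^*\cap\mathrm{Ker}\,F^*)[\tfrac12]\longrightarrow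 k^\times\otimes H^1(\partial M,L^*)[\tfrac12]$$ such that, for every decoration $z$, every closed path $c$ without backtracking in a link and all $n,m\in\mathbb Z$, the value of $R(z)$ on the class of $c\otimes\binom nm$ is $C(c)^m\,C^*(c)^n$. The form $\Omega^*$ is the pullback of $\mathrm{wp}$ by $R$: for all decorations $z,z'$, $$3\cdot\big(z\wedge_{\Omega^*}z'\big)=R(z)\wedge_{3\,\mathrm{wp}}R(z').$$ -/

import Mathlib

open scoped TensorProduct

/- All modules are over `ℤ`; tensor products, submodules, quotients and linear maps are to carry
their own module structure rather than the (equal) one of an arbitrary abelian group. -/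
attribute [instance 50] AddCommGroup.toIntModule

noncomputable section

namespace FlagComplex

/-! ## Multilinear algebra over `ℤ` -/

/-- `ℤ[1/2]`. -/
abbrev ZHalf : Type := Localization.Away (2 : ℤ)

/-- `M[1/2] = M ⊗ ℤ[1/2]` for an abelian group `M`. -/
abbrev Half (M : Type*) [AddCommGroup M] : Type _ := M ⊗[ℤ] ZHalf

/-- The relations `x ∧ y = - y ∧ x`. -/
def wedgeRel (A : Type*) [AddCommGroup A] : Submodule ℤ (A ⊗[ℤ] A) :=
  Submodule.span ℤ {w | ∃ x y : A, w = x ⊗ₜ[ℤ] y + y ⊗ₜ[ℤ] x}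

/-- `A ∧_ℤ A`: generated by bilinear symbols `x ∧ y` with `x ∧ y = - y ∧ x`. It is used for
`A = kˣ`, written additively. -/
abbrev WedgeSq (A : Type*) [AddCommGroup A] : Type _ := (A ⊗[ℤ] A) ⧸ wedgeRel A

/-- The map `(x, y) ↦ x ∧ y`. -/
def wedge (A : Type*) [AddCommGroup A] : A →ₗ[ℤ] A →ₗ[ℤ] WedgeSq A :=
  (TensorProduct.mk ℤ A A).compr₂ (wedgeRel A).mkQ

/-- For an integral bilinear form `B` on `V`, the form `∧_B` on `A ⊗ V` with values in
`A ∧_ℤ A`, characterised by `(x ⊗ v) ∧_B (y ⊗ w) = B(v, w) • (x ∧ y)`. -/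
def wedgeForm (A : Type*) [AddCommGroup A] {V : Type*} [AddCommGroup V]
    (B : LinearMap.BilinForm ℤ V) : (A ⊗[ℤ] V) →ₗ[ℤ] (A ⊗[ℤ] V) →ₗ[ℤ] WedgeSq A :=
  (TensorProduct.map₂ (wedge A) B).compr₂ (TensorProduct.rid ℤ (WedgeSq A)).toLinearMap

theorem wedgeForm_tmul (A : Type*) [AddCommGroup A] {V : Type*} [AddCommGroup V]
    (B : LinearMap.BilinForm ℤ V) (x y : A) (v w : V) :
    wedgeForm A B (x ⊗ₜ v) (y ⊗ₜ w) = B v w • wedge A x y := by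
  simp [wedgeForm]

/-- The extension of `∧_B` to `(A ⊗ V)[1/2]`, with values in `(A ∧_ℤ A)[1/2]`. -/
def wedgeFormHalf (A : Type*) [AddCommGroup A] {V : Type*} [AddCommGroup V]
    (B : LinearMap.BilinForm ℤ V) :
    Half (A ⊗[ℤ] V) →ₗ[ℤ] Half (A ⊗[ℤ] V) →ₗ[ℤ] Half (WedgeSq A) :=
  TensorProduct.map₂ (wedgeForm A B) (LinearMap.mul ℤ ZHalf)

/-- The map `(A ⊗ V)[1/2] → A[1/2]` induced by a linear form `f : V → ℤ`. -/
def applyForm (A : Type*) [AddCommGroup A] {V : Type*} [AddCommGroup V] (f : V →ₗ[ℤ] ℤ) :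
    Half (A ⊗[ℤ] V) →ₗ[ℤ] Half A :=
  ((TensorProduct.rid ℤ A).toLinearMap ∘ₗ f.lTensor A).rTensor ZHalf

/-! ## The root lattice of `sl(3)` and its dual -/

/-- The vector of `{x ∈ ℤ³ : x₁ + x₂ + x₃ = 0}` with coordinates `(n, m)` in the basis
`(1, -1, 0), (0, 1, -1)`. -/
def rootVec (l : Fin 2 → ℤ) : Fin 3 → ℤ := ![l 0, l 1 - l 0, - l 1]

/-- The euclidean product `[ , ]` on `L = {x ∈ ℤ³ : x₁ + x₂ + x₃ = 0} ≅ ℤ²`. -/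
def killing (l l' : Fin 2 → ℤ) : ℤ := rootVec l ⬝ᵥ rootVec l'

/-- The coordinates, in the basis dual to that of `L`, of the element `[l, ·]` of `L*`. -/
def toDual (l : Fin 2 → ℤ) : Fin 2 → ℤ := ![2 * l 0 - l 1, 2 * l 1 - l 0]

/-- Three times the scalar product `⟨ , ⟩` on `L*` dual to `[ , ]`, in the basis dual to that
of `L`: `⟨ , ⟩` has Gram matrix `(2/3, 1/3; 1/3, 2/3)`. -/
def threeDualKilling : LinearMap.BilinForm ℤ (Fin 2 → ℤ) :=
  LinearMap.mk₂ ℤ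
    (fun x y => 2 * (x 0 * y 0) + 2 * (x 1 * y 1) + x 0 * y 1 + x 1 * y 0)
    (by intros; simp; ring) (by intros; simp; ring) (by intros; simp; ring)
    (by intros; simp; ring)

theorem toDual_apply (l l' : Fin 2 → ℤ) :
    toDual l 0 * l' 0 + toDual l 1 * l' 1 = killing l l' := by
  simp [toDual, killing, rootVec, dotProduct, Fin.sum_univ_three]; ring

theorem threeDualKilling_toDual (l l' : Fin 2 → ℤ) :
    threeDualKilling (toDual l) (toDual l') = 3 * killing l l' := by
  simp [threeDualKilling, toDual, killing, rootVec, dotProduct, Fin.sum_univ_three]; ring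

/-! ## One tetrahedron

The vertices of a tetrahedron are the elements of `Fin 4`. -/

/-- Ordered pairs of distinct vertices: the oriented edges of a tetrahedron. -/
abbrev TetEdge : Type := {e : Fin 4 × Fin 4 // e.1 ≠ e.2}

/-- The index set `I` of cardinality 16: `Sum.inl (i, j)` is the index `ij`, and `Sum.inr l` is
the index `ijk` of the face opposite to `l`, oriented so that `(i, j, k, l)` is an even
permutation. -/
abbrev TetIndex : Type := TetEdge ⊕ Fin 4

/-- For `i ≠ j`, the vertex `k` such that `(i, j, k, l)` is an even permutation; then
`third j i = l`. -/
def third : Fin 4 → Fin 4 → Fin 4 :=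
  ![![0, 2, 3, 1], ![3, 1, 0, 2], ![1, 3, 2, 0], ![2, 0, 1, 3]]

theorem third_spec : ∀ π : Equiv.Perm (Fin 4), Equiv.Perm.sign π = 1 →
    third (π 0) (π 1) = π 2 ∧ third (π 1) (π 0) = π 3 := by
  decide

/-- The coefficient of the arrows between the edge `ij` and the face opposite to `m`: it is
`-1` on `ijk` and `1` on `ilj`, where `(i, j, k, l)` is even. -/
def epsEdgeFace (e : TetEdge) (m : Fin 4) : ℤ :=
  if m = third e.1.1 e.1.2 then 1 else if m = third e.1.2 e.1.1 then -1 else 0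

/-- The numbers `ε_{αβ}` (arrows from `α` to `β` minus arrows from `β` to `α`). If
`(i, j, k, l)` is even then `ε_{ij,ik} = 1`, `ε_{ij,il} = -1`, `ε_{ij,ijk} = -1`,
`ε_{ij,ilj} = 1`. -/
def eps : TetIndex → TetIndex → ℤ
  | Sum.inl e, Sum.inl e' =>
      if e'.1.1 = e.1.1 then
        if e'.1.2 = third e.1.1 e.1.2 then 1
        else if e'.1.2 = third e.1.2 e.1.1 then -1 else 0
      else 0
  | Sum.inl e, Sum.inr m => epsEdgeFace e m
  | Sum.inr m, Sum.inl e => - epsEdgeFace e m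
  | Sum.inr _, Sum.inr _ => 0

/-- The edges `12, 21, 34, 43` (here numbered from `0`). -/
def edgeA : Fin 4 → TetEdge :=
  ![⟨(0, 1), by decide⟩, ⟨(1, 0), by decide⟩, ⟨(2, 3), by decide⟩, ⟨(3, 2), by decide⟩]

/-- If `edgeA i = ij` and `(i, j, k, l)` is even then `edgeB i = ik`. -/
def edgeB : Fin 4 → TetEdge :=
  ![⟨(0, 2), by decide⟩, ⟨(1, 3), by decide⟩, ⟨(2, 0), by decide⟩, ⟨(3, 1), by decide⟩]

section Symplectic

variable (τ : Type*)

/-- `J² = ⊕_{t} ℤ^I`, the sum being over a finite set `τ` of tetrahedra. -/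
abbrev J2 : Type _ := τ × TetIndex → ℤ

/-- The basis vector `e_α` of the tetrahedron `t`. -/
def basisVec {τ : Type*} (t : τ) (α : TetIndex) : J2 τ :=
  fun x => by classical exact if x = (t, α) then 1 else 0

variable [Fintype τ]

/-- The form `Ω²` on `J²`, with `Ω²(e_α, e_β) = ε_{αβ}`. As a linear map it is the map
`p : J² → (J²)*`, `p(v) = Ω²(v, ·)`. -/
def Omega2 : LinearMap.BilinForm ℤ (J2 τ) :=
  LinearMap.mk₂ ℤ
    (fun x y => ∑ t : τ, ∑ α : TetIndex, ∑ β : TetIndex, eps α β * (x (t, α) * y (t, β)))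
    (by intros; simp only [← Finset.sum_add_distrib, Pi.add_apply, add_mul, mul_add])
    (by intros
        simp only [Finset.mul_sum, Pi.smul_apply, smul_eq_mul, mul_assoc, mul_left_comm])
    (by intros; simp only [← Finset.sum_add_distrib, Pi.add_apply, mul_add])
    (by intros
        simp only [Finset.mul_sum, Pi.smul_apply, smul_eq_mul, mul_left_comm])

/-- The submodule `J* = Im p` of `(J²)*`. -/
def JStar : Submodule ℤ (Module.Dual ℤ (J2 τ)) := LinearMap.range (Omega2 τ)

/-- The form `Ω* = ⟨H ·, ·⟩`. An element `x` of `J*` is determined by the values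
`x(e_{ij})`, `x(e_{ik})` (`ij = edgeA i`, `ik = edgeB i`); in the corresponding basis `f` of
`J*`, `H(f_{ij}) = f_{ik}` and `H(f_{ik}) = - f_{ij}`. -/
def OmegaStar : LinearMap.BilinForm ℤ (Module.Dual ℤ (J2 τ)) :=
  LinearMap.mk₂ ℤ
    (fun x y => ∑ t : τ, ∑ i : Fin 4,
      (x (basisVec t (Sum.inl (edgeA i))) * y (basisVec t (Sum.inl (edgeB i)))
        - x (basisVec t (Sum.inl (edgeB i))) * y (basisVec t (Sum.inl (edgeA i)))))
    (by intros; simp only [← Finset.sum_add_distrib, LinearMap.add_apply]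
        refine Finset.sum_congr rfl fun _ _ => Finset.sum_congr rfl fun _ _ => ?_
        ring)
    (by intros; simp only [Finset.mul_sum, LinearMap.smul_apply, smul_eq_mul]
        refine Finset.sum_congr rfl fun _ _ => Finset.sum_congr rfl fun _ _ => ?_
        ring)
    (by intros; simp only [← Finset.sum_add_distrib, LinearMap.add_apply]
        refine Finset.sum_congr rfl fun _ _ => Finset.sum_congr rfl fun _ _ => ?_
        ring)
    (by intros; simp only [Finset.mul_sum, LinearMap.smul_apply, smul_eq_mul]
        refine Finset.sum_congr rfl fun _ _ => Finset.sum_congr rfl fun _ _ => ?_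
        ring)

theorem Omega2_basisVec (v : J2 τ) (t : τ) (β : TetIndex) :
    Omega2 τ v (basisVec t β) = ∑ α : TetIndex, eps α β * v (t, α) := by
  classical
  simp only [Omega2, LinearMap.mk₂_apply, basisVec, Prod.mk.injEq, mul_ite, mul_one, mul_zero]
  rw [Finset.sum_eq_single t]
  · simp
  · intro s _ hs; simp [hs]
  · simp

theorem eps_eq : ∀ α β : TetIndex, ∑ i : Fin 4,
    (eps α (Sum.inl (edgeA i)) * eps β (Sum.inl (edgeB i))
      - eps α (Sum.inl (edgeB i)) * eps β (Sum.inl (edgeA i))) = eps α β := by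
  decide +kernel

/-- The forms `Ω*` and `Ω²` correspond to each other through `p`. -/
theorem OmegaStar_Omega2 (v w : J2 τ) :
    OmegaStar τ (Omega2 τ v) (Omega2 τ w) = Omega2 τ v w := by
  have h : ∀ t : τ, ∀ i : Fin 4,
      (∑ α : TetIndex, eps α (Sum.inl (edgeA i)) * v (t, α)) *
          (∑ β : TetIndex, eps β (Sum.inl (edgeB i)) * w (t, β))
        - (∑ α : TetIndex, eps α (Sum.inl (edgeB i)) * v (t, α)) *
          (∑ β : TetIndex, eps β (Sum.inl (edgeA i)) * w (t, β))
      = ∑ α : TetIndex, ∑ β : TetIndex,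
        (eps α (Sum.inl (edgeA i)) * eps β (Sum.inl (edgeB i))
          - eps α (Sum.inl (edgeB i)) * eps β (Sum.inl (edgeA i))) * (v (t, α) * w (t, β)) := by
    intro t i
    rw [Finset.sum_mul_sum, Finset.sum_mul_sum, ← Finset.sum_sub_distrib]
    refine Finset.sum_congr rfl fun α _ => ?_
    rw [← Finset.sum_sub_distrib]
    exact Finset.sum_congr rfl fun β _ => by ring
  simp only [OmegaStar, LinearMap.mk₂_apply, Omega2_basisVec, h]
  simp only [Omega2, LinearMap.mk₂_apply]
  refine Finset.sum_congr rfl fun t _ => ?_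
  rw [Finset.sum_comm]
  refine Finset.sum_congr rfl fun α _ => ?_
  rw [Finset.sum_comm]
  refine Finset.sum_congr rfl fun β _ => ?_
  rw [← Finset.sum_mul, eps_eq]

end Symplectic

/-! ## Closed oriented tetrahedra complexes -/

/-- A closed oriented quasi-simplicial complex of dimension three, presented as a set `τ` of
tetrahedra with vertices `Fin 4` whose faces are glued in pairs. The face of `t` opposite to `l`
is glued to a face of `tet t l`; the gluing sends a vertex `i ≠ l` of `t` to the vertex
`perm t l i` of `tet t l`, and `perm t l l` is the vertex opposite to the face glued to. The
numbering of the vertices of each tetrahedron is positive for the orientation, so that the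
gluings, which reverse the orientation of the faces, are the odd permutations. -/
structure ClosedComplex (τ : Type*) where
  tet : τ → Fin 4 → τ
  perm : τ → Fin 4 → Equiv.Perm (Fin 4)
  sign_perm : ∀ t l, Equiv.Perm.sign (perm t l) = -1
  tet_tet : ∀ t l, tet (tet t l) (perm t l l) = t
  perm_perm : ∀ t l, perm (tet t l) (perm t l l) = (perm t l)⁻¹
  not_self : ∀ t l, ¬ (tet t l = t ∧ perm t l l = l)

namespace ClosedComplex

variable {τ : Type*} (K : ClosedComplex τ)

/-! ### Edge and face conditions -/

/-- The identifications of oriented edges, and of faces, made by the gluings. -/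
inductive CellRel : τ × TetIndex → τ × TetIndex → Prop
  | edge (t : τ) (e : TetEdge) (m : Fin 4) (h₁ : m ≠ e.1.1) (h₂ : m ≠ e.1.2) :
      CellRel (t, Sum.inl e)
        (K.tet t m, Sum.inl ⟨(K.perm t m e.1.1, K.perm t m e.1.2),
          fun h => e.2 ((K.perm t m).injective h)⟩)
  | face (t : τ) (l : Fin 4) :
      CellRel (t, Sum.inr l) (K.tet t l, Sum.inr (K.perm t l l))

/-- The oriented edges and the faces of `K`. -/
def Cell : Type _ := Quot K.CellRel

/-- The map `F : C₁^or + C₂ → J²`, sending an oriented edge, resp. a face, of `K` to the sum of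
the vectors `e_α` over all the oriented edges, resp. faces, of tetrahedra identified with it. -/
def F : (K.Cell → ℤ) →ₗ[ℤ] J2 τ :=
  LinearMap.funLeft ℤ ℤ (Quot.mk K.CellRel)

/-- The module `J* ∩ Ker(F*)`. -/
def decorationModule [Fintype τ] : Submodule ℤ (Module.Dual ℤ (J2 τ)) :=
  JStar τ ⊓ LinearMap.ker K.F.dualMap

/-- The form `Ω*` on `J* ∩ Ker(F*)`. -/
def omegaStar [Fintype τ] : LinearMap.BilinForm ℤ K.decorationModule :=
  (OmegaStar τ).compl₁₂ K.decorationModule.subtype K.decorationModule.subtype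

/-- The space of decorations `k^× ⊗ (J* ∩ Ker(F*))[1/2]`. -/
abbrev Decoration [Fintype τ] (k : Type*) [Field k] : Type _ :=
  Half (Additive kˣ ⊗[ℤ] K.decorationModule)

/-- The value `z(v) ∈ k^×[1/2]` (written additively) of a decoration `z`, seen as an element of
`Hom(J², k^×)[1/2]`, at `v ∈ J²`. -/
def value [Fintype τ] (k : Type*) [Field k] (v : J2 τ) :
    K.Decoration k →ₗ[ℤ] Half (Additive kˣ) :=
  applyForm (Additive kˣ) (Module.Dual.eval ℤ (J2 τ) v ∘ₗ K.decorationModule.subtype)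

/-! ### The links of the vertices

The link of a vertex is a closed oriented surface, triangulated by the triangles `(t, i)`, the
traces of the tetrahedra `t` near their vertices `i`; the triangle `(t, i)` has a corner `j` for
every `j ≠ i` (the trace of the edge `ij`) and a side for every face of `t` containing `i`. The
flag `(t, π)` is the one given by the corner `π 1` of the triangle `(t, π 0)`, by its side
from the corner `π 1` to the corner `π 2` (the trace of the face opposite to `π 3`) and by the
triangle. These flags are the triangles of the first barycentric subdivision of the links; the
vertices of a flag are its corner (number `0`), the midpoint of its side (number `1`) and the
centre of its triangle (number `2`). -/

/-- The flags of the links. -/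
abbrev Flag (τ : Type*) : Type _ := τ × Equiv.Perm (Fin 4)

/-- The flag adjacent to a given one, with another corner (`0`), side (`1`) or triangle (`2`) and
the same other elements. -/
def move : Fin 3 → Flag τ → Flag τ :=
  ![fun c => (c.1, c.2 * Equiv.swap 1 2),
    fun c => (c.1, c.2 * Equiv.swap 2 3),
    fun c => (K.tet c.1 (c.2 3), K.perm c.1 (c.2 3) * c.2)]

theorem move_move (a : Fin 3) (c : Flag τ) : K.move a (K.move a c) = c := by
  obtain ⟨t, π⟩ := c
  fin_cases a
  · simp [move, mul_assoc]
  · simp [move, mul_assoc]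
  · simp [move, K.tet_tet, K.perm_perm]

/-- The orientation sign of a flag. A corner, the midpoint of a side and the centre of a triangle
turn counterclockwise, for an observer at the vertex of `K`, if the sign is `1`. This is the
orientation of the links as boundary of the complement of a neighbourhood of the vertices. -/
def orient (c : Flag τ) : ℤ := (Equiv.Perm.sign c.2 : ℤ)

theorem orient_move (a : Fin 3) (c : Flag τ) : orient (K.move a c) = - orient c := by
  obtain ⟨t, π⟩ := c
  fin_cases a
  · have h : Equiv.Perm.sign (Equiv.swap (1 : Fin 4) 2) = -1 := by decide
    simp [move, orient, h]
  · have h : Equiv.Perm.sign (Equiv.swap (2 : Fin 4) 3) = -1 := by decide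
    simp [move, orient, h]
  · simp [move, orient, K.sign_perm]

/-- The corners (`a = 0`), sides (`a = 1`) and triangles (`a = 2`) of the links. -/
def LinkCell (a : Fin 3) : Type _ :=
  Quot fun c d : Flag τ => ∃ b, b ≠ a ∧ d = K.move b c

/-- The vertices of `K`, that is, the connected components of the links. -/
def Vertex : Type _ := Quot fun c d : Flag τ => ∃ b, d = K.move b c

/-- The vertex of `K` whose link contains a given corner, side or triangle. -/
def LinkCell.vertex {K : ClosedComplex τ} {a : Fin 3} (s : K.LinkCell a) : K.Vertex :=
  Quot.map id (fun _ _ ⟨b, _, h⟩ => ⟨b, h⟩) s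

/-- The Euler characteristic of the link of a vertex. -/
def eulerChar (v : K.Vertex) : ℤ :=
  (Nat.card {s : K.LinkCell 0 // s.vertex = v} : ℤ)
    - Nat.card {s : K.LinkCell 1 // s.vertex = v}
    + Nat.card {s : K.LinkCell 2 // s.vertex = v}

/-- Every link is a torus: the links being closed, connected and orientable surfaces, this means
that their Euler characteristic is zero. -/
def HasTorusLinks : Prop := ∀ v : K.Vertex, K.eulerChar v = 0

/-! ### Cohomology of the boundary

`∂M` is the union of the links. Its cohomology is that of the first barycentric subdivision, with
coefficients in `L* = ℤ²`. A cochain of degree one is a family of functions on flags: the `a`-th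
one gives the values on the edge of the flag opposite to its vertex number `a`, oriented towards
the vertex with the larger number. -/

/-- Families of three functions on flags, with values in `L*`. -/
abbrev FlagFun (τ : Type*) : Type _ := Fin 3 → Flag τ → Fin 2 → ℤ

/-- The cochains of degree `0`: the value `g a c` is the value at the vertex number `a` of `c`. -/
def C0 : Submodule ℤ (FlagFun τ) where
  carrier := {g | ∀ a b, b ≠ a → ∀ c, g a (K.move b c) = g a c}
  zero_mem' := by intro a b _ c; rfl
  add_mem' := by intro g g' h h' a b hb c; simp [h a b hb c, h' a b hb c]
  smul_mem' := by intro r g h a b hb c; simp [h a b hb c]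

/-- The coboundary of a cochain of degree `0`. -/
def d0 : FlagFun τ →ₗ[ℤ] FlagFun τ where
  toFun g := ![g 2 - g 1, g 2 - g 0, g 1 - g 0]
  map_add' g g' := by
    funext a c i; fin_cases a <;> simp <;> ring
  map_smul' r g := by
    funext a c i; fin_cases a <;> simp <;> ring

/-- The cocycles of degree `1`. -/
def Z1 : Submodule ℤ (FlagFun τ) where
  carrier := {x | (∀ a c, x a (K.move a c) = x a c) ∧ ∀ c, x 0 c - x 1 c + x 2 c = 0}
  zero_mem' := by constructor <;> intros <;> simp
  add_mem' := by
    rintro x y ⟨h₁, h₂⟩ ⟨h₁', h₂'⟩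
    refine ⟨fun a c => by simp [h₁ a c, h₁' a c], fun c => ?_⟩
    have e := congrArg₂ (· + ·) (h₂ c) (h₂' c)
    simp only [Pi.add_apply, add_zero] at e ⊢
    rw [← e]; abel
  smul_mem' := by
    rintro r x ⟨h₁, h₂⟩
    refine ⟨fun a c => by simp [h₁ a c], fun c => ?_⟩
    have e := congrArg (r • ·) (h₂ c)
    simp only [Pi.smul_apply, smul_add, smul_sub, smul_zero] at e ⊢
    exact e

/-- The coboundaries of degree `1`. -/
def B1 : Submodule ℤ (FlagFun τ) := K.C0.map d0

/-- `H¹(∂M, L*)`. -/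
abbrev H1 : Type _ := K.Z1 ⧸ K.B1.comap K.Z1.subtype

section WeilPetersson

variable [Fintype τ]

/-- Three times the evaluation on the fundamental class `∑ orient(c) c` of `∂M` of the
Alexander-Whitney cup product `(φ ∪ ψ)([v₀, v₁, v₂]) = ⟨φ([v₀, v₁]), ψ([v₁, v₂])⟩`. -/
def threeCup : LinearMap.BilinForm ℤ (FlagFun τ) :=
  LinearMap.mk₂ ℤ (fun x y => ∑ c : Flag τ, orient c * threeDualKilling (x 2 c) (y 0 c))
    (by intros; simp [mul_add, Finset.sum_add_distrib])
    (by intros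
        simp only [Pi.smul_apply, map_smul, LinearMap.smul_apply, smul_eq_mul, Finset.mul_sum,
          mul_left_comm])
    (by intros; simp [mul_add, Finset.sum_add_distrib])
    (by intros
        simp only [Pi.smul_apply, map_smul, smul_eq_mul, Finset.mul_sum,
          mul_left_comm])

theorem sum_orient_eq_zero (a : Fin 3) (f : Flag τ → ℤ) (hf : ∀ c, f (K.move a c) = f c) :
    ∑ c : Flag τ, orient c * f c = 0 := by
  have h : ∑ c : Flag τ, orient c * f c
      = ∑ c : Flag τ, orient (K.move a c) * f (K.move a c) :=
    (Equiv.sum_comp (Function.Involutive.toPerm (K.move a) (K.move_move a))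
      fun c => orient c * f c).symm
  simp only [orient_move, hf, neg_mul, Finset.sum_neg_distrib] at h
  linarith

theorem threeCup_coboundary_left {g y : FlagFun τ} (hg : g ∈ K.C0) (hy : y ∈ K.Z1) :
    threeCup (d0 g) y = 0 := by
  obtain ⟨hy₁, hy₂⟩ := hy
  have e : ∀ c, orient c * threeDualKilling (d0 g 2 c) (y 0 c)
      = orient c * threeDualKilling (g 1 c) (y 0 c)
        - orient c * threeDualKilling (g 0 c) (y 1 c)
        + orient c * threeDualKilling (g 0 c) (y 2 c) := by
    intro c
    have h : y 1 c = y 0 c + y 2 c := by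
      have := hy₂ c
      rw [sub_add_eq_add_sub, sub_eq_zero] at this
      exact this.symm
    have h' : d0 g 2 c = g 1 c - g 0 c := rfl
    rw [h, h']; simp only [map_sub, map_add, LinearMap.sub_apply]; ring
  simp only [threeCup, LinearMap.mk₂_apply, e, Finset.sum_add_distrib, Finset.sum_sub_distrib]
  rw [K.sum_orient_eq_zero 0, K.sum_orient_eq_zero 1, K.sum_orient_eq_zero 2]
  · simp
  · intro c; rw [hy₁ 2 c, hg 0 2 (by decide) c]
  · intro c; rw [hy₁ 1 c, hg 0 1 (by decide) c]
  · intro c; rw [hy₁ 0 c, hg 1 0 (by decide) c]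

theorem threeCup_coboundary_right {x g : FlagFun τ} (hx : x ∈ K.Z1) (hg : g ∈ K.C0) :
    threeCup x (d0 g) = 0 := by
  obtain ⟨hx₁, hx₂⟩ := hx
  have e : ∀ c, orient c * threeDualKilling (x 2 c) (d0 g 0 c)
      = orient c * threeDualKilling (x 1 c) (g 2 c)
        - orient c * threeDualKilling (x 0 c) (g 2 c)
        - orient c * threeDualKilling (x 2 c) (g 1 c) := by
    intro c
    have h : x 1 c = x 0 c + x 2 c := by
      have := hx₂ c
      rw [sub_add_eq_add_sub, sub_eq_zero] at this
      exact this.symm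
    have h' : d0 g 0 c = g 2 c - g 1 c := rfl
    rw [h, h']; simp only [map_sub, map_add, LinearMap.add_apply]; ring
  simp only [threeCup, LinearMap.mk₂_apply, e, Finset.sum_sub_distrib]
  rw [K.sum_orient_eq_zero 1, K.sum_orient_eq_zero 0, K.sum_orient_eq_zero 2]
  · simp
  · intro c; rw [hx₁ 2 c, hg 1 2 (by decide) c]
  · intro c; rw [hx₁ 0 c, hg 2 0 (by decide) c]
  · intro c; rw [hx₁ 1 c, hg 2 1 (by decide) c]

/-- Three times the Goldman-Weil-Petersson form `wp` on `H¹(∂M, L*)`, the coupling of the cup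
product and of the scalar product `⟨ , ⟩`. The factor makes the form integral. -/
def threeWP : LinearMap.BilinForm ℤ K.H1 :=
  LinearMap.liftQ₂ _ _ (threeCup.compl₁₂ K.Z1.subtype K.Z1.subtype)
    (by
      rintro x ⟨g, hg, hx⟩
      refine LinearMap.mem_ker.2 (LinearMap.ext fun y => ?_)
      have h : d0 g = (x : FlagFun τ) := hx
      simpa [← h] using K.threeCup_coboundary_left hg y.2)
    (by
      rintro y ⟨g, hg, hy⟩
      refine LinearMap.mem_ker.2 (LinearMap.ext fun x => ?_)
      have h : d0 g = (y : FlagFun τ) := hy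
      simpa [← h] using K.threeCup_coboundary_right x.2 hg)

end WeilPetersson

/-! ### The boundary holonomy -/

/-- A closed path without backtracking in a link, as a succession of turns. The turn `c` enters
the triangle of the flag `c` through the side of `c` and leaves it through the other side having
the corner of `c`, so it turns around that corner. The path then enters the triangle adjacent to
this last side, where it turns around either end of the side. -/
structure Loop where
  length : ℕ
  turn : ℕ → Flag τ
  step : ∀ a < length, turn (a + 1) = K.move 2 (K.move 1 (turn a)) ∨
    turn (a + 1) = K.move 0 (K.move 2 (K.move 1 (turn a)))
  closed : turn length = turn 0

/-- The value of a cochain on a loop; during a turn the path goes from the midpoint of a side to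
the centre of the triangle and then to the midpoint of another side. -/
def evalCochain {K : ClosedComplex τ} (γ : K.Loop) (a : Fin 2) : FlagFun τ →ₗ[ℤ] ℤ where
  toFun x := ∑ s ∈ Finset.range γ.length,
    (x 0 (γ.turn s) a - x 0 (K.move 1 (γ.turn s)) a)
  map_add' x y := by
    rw [← Finset.sum_add_distrib]
    refine Finset.sum_congr rfl fun s _ => ?_
    simp only [Pi.add_apply]; ring
  map_smul' r x := by
    simp only [Pi.smul_apply, smul_eq_mul, ← mul_sub, Finset.mul_sum, RingHom.id_apply]

theorem evalCochain_coboundary {K : ClosedComplex τ} (γ : K.Loop) (a : Fin 2) {g : FlagFun τ}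
    (hg : g ∈ K.C0) : evalCochain γ a (d0 g) = 0 := by
  have e : ∀ s ∈ Finset.range γ.length,
      (d0 g 0 (γ.turn s) a - d0 g 0 (K.move 1 (γ.turn s)) a)
        = g 1 (γ.turn (s + 1)) a - g 1 (γ.turn s) a := by
    intro s hs
    have h₁ : g 1 (γ.turn (s + 1)) = g 1 (K.move 1 (γ.turn s)) := by
      rcases γ.step s (Finset.mem_range.1 hs) with h | h <;> rw [h]
      · rw [hg 1 2 (by decide)]
      · rw [hg 1 0 (by decide), hg 1 2 (by decide)]
    have h₂ : g 2 (K.move 1 (γ.turn s)) = g 2 (γ.turn s) := hg 2 1 (by decide) _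
    have h₃ : ∀ c, d0 g 0 c a = g 2 c a - g 1 c a := fun _ => rfl
    rw [h₁, h₃, h₃, h₂]; ring
  change ∑ s ∈ Finset.range γ.length, _ = _
  rw [Finset.sum_congr rfl e, Finset.sum_range_sub (fun s => g 1 (γ.turn s) a), γ.closed, sub_self]

/-- The evaluation `H¹(∂M, L*) → ℤ` on the class of `γ ⊗ l` in `H₁(∂M, L)`, for `l` in `L = ℤ²`. -/
def evalClass {K : ClosedComplex τ} (γ : K.Loop) (l : Fin 2 → ℤ) : K.H1 →ₗ[ℤ] ℤ :=
  Submodule.liftQ _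
    ((l 0 • evalCochain γ 0 + l 1 • evalCochain γ 1) ∘ₗ K.Z1.subtype)
    (by
      rintro x ⟨g, hg, hx⟩
      have h : d0 g = (x : FlagFun τ) := hx
      simp [← h, evalCochain_coboundary γ _ hg])

/-- The matrix of the change of projective basis under a cyclic permutation of three flags with
triple ratio `X`. -/
def cyclicMatrix {k : Type*} [Field k] (X : k) : Matrix (Fin 3) (Fin 3) k :=
  !![X, X + 1, 1; -X, -X, 0; X, 0, 0]

/-- The matrix `E(x, y)`; the holonomy of the path turning left around the edge `ij` is
`E(z_{ij}, z_{ji})`. -/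
def edgeMatrix {k : Type*} [Field k] (x y : k) : Matrix (Fin 3) (Fin 3) k :=
  !![y⁻¹, 0, 0; 0, 1, 0; 0, 0, x]

/-- The holonomy `T(z_{ikj}) E(z_{ji}, z_{ij}) T(z_{ilj})²` of the path turning right around `ij`
is upper triangular, and up to a scalar `s` its diagonal is
`(z_{ji} z_{ilj} z_{ijk}, 1, 1 / z_{ij})`, where `z_{ikj} = 1 / z_{ijk}`. -/
theorem rightTurn {k : Type*} [Field k] (zij zji zijk zilj : k) (h : zijk ≠ 0) :
    let m := cyclicMatrix zijk⁻¹ * (edgeMatrix zji zij * (cyclicMatrix zilj * cyclicMatrix zilj))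
    let s := zijk⁻¹ * zilj
    m 1 0 = 0 ∧ m 2 0 = 0 ∧ m 2 1 = 0 ∧
      m 0 0 = s * (zji * zilj * zijk) ∧ m 1 1 = s ∧ m 2 2 = s * zij⁻¹ := by
  simp only [cyclicMatrix, edgeMatrix, Matrix.mul_apply, Fin.sum_univ_three]
  refine ⟨?_, ?_, ?_, ?_, ?_, ?_⟩ <;> simp <;> field_simp <;> ring_nf <;> simp

/-- The holonomy of a turn is triangular with diagonal `(1/C*, 1, C)`. The functions `C*`
(`a = 0`) and `C` (`a = 1`) of the coordinates are written as vectors of `J²`. A turn `(t, π)` is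
around the edge `ij`, `i = π 0` and `j = π 1`. If it is a left turn, `C* = z_{ji}` and
`C = z_{ij}`. If it is a right turn, `C* = (z_{ji} z_{ijk} z_{ilj})⁻¹` and `C = z_{ij}⁻¹`, where
`ijk` and `ilj` are the faces of the tetrahedron `t` that contain `ij`, that is, those opposite
to `π 2` and to `π 3`. -/
def turnVec (c : Flag τ) (a : Fin 2) : J2 τ :=
  let ij : TetEdge := ⟨(c.2 0, c.2 1), fun h => absurd (c.2.injective h) (by decide)⟩
  let ji : TetEdge := ⟨(c.2 1, c.2 0), fun h => absurd (c.2.injective h) (by decide)⟩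
  if Equiv.Perm.sign c.2 = 1 then
    ![basisVec c.1 (Sum.inl ji), basisVec c.1 (Sum.inl ij)] a
  else
    ![-(basisVec c.1 (Sum.inl ji) + basisVec c.1 (Sum.inr (c.2 2))
        + basisVec c.1 (Sum.inr (c.2 3))), -basisVec c.1 (Sum.inl ij)] a

/-- The diagonal part `(1/C*, 1, C)` of the holonomy of a loop: `C*` for `a = 0`, `C` for
`a = 1`. -/
def holonomy [Fintype τ] {K : ClosedComplex τ} (k : Type*) [Field k] (γ : K.Loop) (a : Fin 2)
    (z : K.Decoration k) : Half (Additive kˣ) :=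
  ∑ s ∈ Finset.range γ.length, K.value k (turnVec (γ.turn s) a) z

/-- `R : k^× ⊗ (J* ∩ Ker(F*))[1/2] → k^× ⊗ H¹(∂M, L*)[1/2]` is the boundary holonomy map: for
every decoration `z` and every loop `γ` with holonomy `(1/C*, 1, C)`, the value of `R(z)` on
`γ ⊗ (n, m)` is `C^m (C*)^n`, written additively. -/
def IsBoundaryHolonomy [Fintype τ] (k : Type*) [Field k]
    (R : K.Decoration k →ₗ[ℤ] Half (Additive kˣ ⊗[ℤ] K.H1)) : Prop :=
  ∀ (z : K.Decoration k) (γ : K.Loop) (n m : ℤ),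
    applyForm (Additive kˣ) (evalClass γ ![n, m]) (R z)
      = m • holonomy k γ 1 z + n • holonomy k γ 0 z


end ClosedComplex

end FlagComplex

end

/-! Uniqueness: the loops without backtracking separate the points of `(A ⊗ H¹)[1/2]`. If the sums
of a cocycle along these loops vanish, it has a potential on sides, which a priori depends on the
direction in which a side is crossed. Comparing the directions around a triangle, which has an odd
number of sides, shows that twice the discrepancy is zero, and 2 is invertible (`exists_primitive`).
Since the cocycles form a direct summand of a free module, this passes to tensors
(`eq_zero_of_evalClass`).

Existence: because of the face coordinates, the holonomy of a turn is not inverted when the turn is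
reversed. Doubling it and sharing the face coordinates evenly gives the antisymmetric function
`turnVal`. Along a loop the corrections cancel, because a decoration takes opposite values on glued
faces (`sum_turnVal_loop`). The sums of `turnVal` vanish around triangles by the relations of `J*`
and around corners by `F*`, so it comes from a cocycle (`exists_cocycle_turnVal`). The map `R` is
half of the resulting map to `H¹`.

Pullback: the cup product contains the component `ξ 2` along the links' sides, which is not
determined inside one tetrahedron. The fundamental class changes sign under every `move a`, so
averaging over `move 1` replaces `ξ 2` by its variation `turnVal`. What resists is constant around
an edge of `K`, because `z_{ji}` is both the `C*` of the end `i` and the `C` of the end `j`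
(`flipEnds`); it contributes zero (`two_threeCup`). Normalising the second cocycle at the centres of
triangles makes all terms local, and a polynomial identity in one tetrahedron (`sum_localTerm`)
gives `12 Ω*`: a factor 3 from `threeWP` and 4 from doubling both holonomies. -/

noncomputable section

namespace FlagComplex

/-! ## Potentials for permutations -/

/-- One step of a walk along the permutations `σ i`, accumulating the values of `h`. -/
def WalkStep {α ι A : Type*} [AddCommGroup A] (σ : ι → Equiv.Perm α) (h : α → A)
    (p q : α × A) : Prop :=
  ∃ i, q = (σ i p.1, p.2 + h p.1)

section Potential

variable {α ι A : Type*} [AddCommGroup A] {σ : ι → Equiv.Perm α} {h : α → A}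

theorem exists_walk {p q : α × A} (H : Relation.ReflTransGen (WalkStep σ h) p q) :
    ∃ (n : ℕ) (w : ℕ → α), w 0 = p.1 ∧ w n = q.1 ∧ (∀ a < n, ∃ i, w (a + 1) = σ i (w a)) ∧
      q.2 = p.2 + ∑ a ∈ Finset.range n, h (w a) := by
  induction H with
  | refl => exact ⟨0, fun _ => p.1, rfl, rfl, by simp, by simp⟩
  | @tail b c _ hbc ih =>
    obtain ⟨n, w, h0, hn, hs, hv⟩ := ih
    obtain ⟨i, rfl⟩ := hbc
    refine ⟨n + 1, fun m => if m ≤ n then w m else σ i b.1, by simp [h0], by simp, ?_, ?_⟩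
    · intro a ha
      rcases Nat.lt_succ_iff_lt_or_eq.1 ha with ha | rfl
      · obtain ⟨j, hj⟩ := hs a ha
        exact ⟨j, by simp [ha.le, Nat.succ_le_of_lt ha, hj]⟩
      · exact ⟨i, by simp [hn]⟩
    · have e : ∑ a ∈ Finset.range n, h (if a ≤ n then w a else σ i b.1)
          = ∑ a ∈ Finset.range n, h (w a) :=
        Finset.sum_congr rfl fun a ha => by simp [(Finset.mem_range.1 ha).le]
      rw [Finset.sum_range_succ, e]
      simp [hn, hv, add_assoc]

theorem walk_pow (i : ι) (n : ℕ) (p : α × A) :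
    ∃ e, Relation.ReflTransGen (WalkStep σ h) p ((σ i ^ n) p.1, e) := by
  induction n with
  | zero => exact ⟨p.2, by simpa using Relation.ReflTransGen.refl⟩
  | succ n ih =>
    obtain ⟨e, he⟩ := ih
    exact ⟨e + h ((σ i ^ n) p.1), he.tail ⟨i, by simp [pow_succ']⟩⟩

theorem walk_translate (e : A) {p q : α × A} (H : Relation.ReflTransGen (WalkStep σ h) p q) :
    Relation.ReflTransGen (WalkStep σ h) (p.1, p.2 + e) (q.1, q.2 + e) := by
  refine Relation.ReflTransGen.lift (r := WalkStep σ h) (fun p : α × A => (p.1, p.2 + e)) ?_ _ _ H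
  rintro p _ ⟨i, rfl⟩
  exact ⟨i, by simp [add_right_comm]⟩

/-- If the sums of `h` over the closed walks along the permutations `σ i` vanish, then `h` is
the variation of a function along each of these permutations. -/
theorem exists_potential [Finite α]
    (hz : ∀ (n : ℕ) (w : ℕ → α), (∀ a < n, ∃ i, w (a + 1) = σ i (w a)) → w n = w 0 →
      ∑ a ∈ Finset.range n, h (w a) = 0) :
    ∃ u : α → A, ∀ i c, u (σ i c) = u c + h c := by
  classical
  have closed : ∀ {p q : α × A}, Relation.ReflTransGen (WalkStep σ h) p q → p.1 = q.1 →
      p = q := by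
    intro p q H e
    obtain ⟨n, w, h0, hn, hs, hv⟩ := exists_walk H
    rw [hz n w hs (by rw [h0, hn, e]), add_zero] at hv
    exact Prod.ext e hv.symm
  -- Walks only go forward. A step along `σ i`, of order `m`, is undone by `m - 1` more steps along
  -- `σ i`, and `closed` forces the accumulated value to return to its start.
  have symm : ∀ {p q : α × A}, Relation.ReflTransGen (WalkStep σ h) p q →
      Relation.ReflTransGen (WalkStep σ h) q p := by
    intro p q H
    induction H with
    | refl => exact .refl
    | @tail b c _ hbc ih =>
      refine Relation.ReflTransGen.trans ?_ ih
      obtain ⟨i, hi⟩ := hbc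
      obtain ⟨m, hm, hm'⟩ := isOfFinOrder_iff_pow_eq_one.1 (isOfFinOrder_of_finite (σ i))
      obtain ⟨e, he⟩ := walk_pow (h := h) i (m - 1) c
      have e1 : (σ i ^ (m - 1)) c.1 = b.1 := by
        rw [hi]
        change ((σ i ^ (m - 1)) * σ i) b.1 = b.1
        rw [← pow_succ, Nat.sub_add_cancel hm, hm']; rfl
      rw [e1] at he
      have := closed (Relation.ReflTransGen.head ⟨i, hi⟩ he) rfl
      rwa [← this] at he
  let s : Setoid α :=
    { r := fun c d => ∃ b, Relation.ReflTransGen (WalkStep σ h) (c, 0) (d, b)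
      iseqv :=
        { refl := fun c => ⟨0, .refl⟩
          symm := by
            rintro c d ⟨b, H⟩
            exact ⟨-b, by simpa using walk_translate (-b) (symm H)⟩
          trans := by
            rintro c d e ⟨b, H⟩ ⟨b', H'⟩
            exact ⟨b' + b, H.trans (by simpa using walk_translate b H')⟩ } }
  -- The potential at `c` is the value accumulated from the chosen representative of the class of
  -- `c`.
  have hrep : ∀ c, ∃ b, Relation.ReflTransGen (WalkStep σ h) ((Quotient.mk s c).out, 0) (c, b) :=
    fun c => Quotient.exact (Quotient.out_eq (Quotient.mk s c))
  choose u hu using hrep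
  refine ⟨u, fun i c => ?_⟩
  have e : Quotient.mk s (σ i c) = Quotient.mk s c :=
    (Quotient.sound (⟨h c, .single ⟨i, by simp⟩⟩ : s.r c (σ i c))).symm
  have H1 := hu (σ i c)
  rw [e] at H1
  have H2 : Relation.ReflTransGen (WalkStep σ h) _ (σ i c, u c + h c) := (hu c).tail ⟨i, rfl⟩
  exact congrArg Prod.snd (closed ((symm H1).trans H2) rfl)

end Potential

/-! ## Linear forms on `(A ⊗ V)[1/2]` -/

section HalfTensor

variable (A : Type*) [AddCommGroup A]
variable {V W : Type*} [AddCommGroup V] [AddCommGroup W]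

/-- The map `(A ⊗ V)[1/2] → (A ⊗ W)[1/2]` induced by a linear map `V → W`. -/
def halfMap (f : V →ₗ[ℤ] W) : Half (A ⊗[ℤ] V) →ₗ[ℤ] Half (A ⊗[ℤ] W) :=
  (f.lTensor A).rTensor ZHalf

/-- The map `A[1/2] → (A ⊗ V)[1/2]` induced by a vector of `V`. -/
def place (v : V) : Half A →ₗ[ℤ] Half (A ⊗[ℤ] V) :=
  ((TensorProduct.mk ℤ A V).flip v).rTensor ZHalf

variable {A}

theorem half_tensor_induction {p : Half (A ⊗[ℤ] V) → Prop}
    (tmul : ∀ (x : A) (v : V) (r : ZHalf), p ((x ⊗ₜ v) ⊗ₜ r))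
    (add : ∀ z z', p z → p z' → p (z + z')) (z : Half (A ⊗[ℤ] V)) : p z := by
  have zero : p 0 := by simpa using tmul 0 0 0
  induction z using TensorProduct.induction_on with
  | zero => exact zero
  | add z z' h h' => exact add z z' h h'
  | tmul y r =>
    induction y using TensorProduct.induction_on with
    | zero => simpa using zero
    | add y y' h h' => rw [TensorProduct.add_tmul]; exact add _ _ h h'
    | tmul x v => exact tmul x v r

@[simp] theorem applyForm_tmul (f : V →ₗ[ℤ] ℤ) (x : A) (v : V) (r : ZHalf) :
    applyForm A f ((x ⊗ₜ v) ⊗ₜ r) = (f v • x) ⊗ₜ r := rfl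

@[simp] theorem halfMap_tmul (f : V →ₗ[ℤ] W) (x : A) (v : V) (r : ZHalf) :
    halfMap A f ((x ⊗ₜ v) ⊗ₜ r) = (x ⊗ₜ f v) ⊗ₜ r := rfl

@[simp] theorem place_tmul (x : A) (v : V) (r : ZHalf) :
    place A v (x ⊗ₜ r) = (x ⊗ₜ v) ⊗ₜ r := rfl

theorem applyForm_add (f g : V →ₗ[ℤ] ℤ) (z : Half (A ⊗[ℤ] V)) :
    applyForm A (f + g) z = applyForm A f z + applyForm A g z := by
  induction z using half_tensor_induction with
  | tmul x v r => simp [add_smul, TensorProduct.add_tmul]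
  | add z z' h h' => simp only [map_add, h, h', add_add_add_comm]

theorem applyForm_smul (n : ℤ) (f : V →ₗ[ℤ] ℤ) (z : Half (A ⊗[ℤ] V)) :
    applyForm A (n • f) z = n • applyForm A f z := by
  induction z using half_tensor_induction with
  | tmul x v r => simp [mul_smul, TensorProduct.smul_tmul']
  | add z z' h h' => simp only [map_add, h, h', smul_add]

theorem applyForm_zero (z : Half (A ⊗[ℤ] V)) : applyForm A (0 : V →ₗ[ℤ] ℤ) z = 0 := by
  simpa using applyForm_smul 0 (0 : V →ₗ[ℤ] ℤ) z

theorem applyForm_sub (f g : V →ₗ[ℤ] ℤ) (z : Half (A ⊗[ℤ] V)) :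
    applyForm A (f - g) z = applyForm A f z - applyForm A g z := by
  rw [eq_sub_iff_add_eq, ← applyForm_add, sub_add_cancel]

theorem applyForm_sum {ι : Type*} (s : Finset ι) (f : ι → V →ₗ[ℤ] ℤ) (z : Half (A ⊗[ℤ] V)) :
    applyForm A (∑ i ∈ s, f i) z = ∑ i ∈ s, applyForm A (f i) z := by
  classical
  induction s using Finset.induction_on with
  | empty => simp [applyForm_zero]
  | insert i s hi ih => rw [Finset.sum_insert hi, Finset.sum_insert hi, applyForm_add, ih]

theorem applyForm_halfMap (g : W →ₗ[ℤ] ℤ) (f : V →ₗ[ℤ] W) (z : Half (A ⊗[ℤ] V)) :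
    applyForm A g (halfMap A f z) = applyForm A (g ∘ₗ f) z := by
  induction z using half_tensor_induction with
  | tmul x v r => simp
  | add z z' h h' => simp only [map_add, h, h']

theorem halfMap_halfMap {U : Type*} [AddCommGroup U] (g : W →ₗ[ℤ] U) (f : V →ₗ[ℤ] W)
    (z : Half (A ⊗[ℤ] V)) : halfMap A g (halfMap A f z) = halfMap A (g ∘ₗ f) z := by
  induction z using half_tensor_induction with
  | tmul x v r => simp
  | add z z' h h' => simp only [map_add, h, h']

theorem halfMap_zero (z : Half (A ⊗[ℤ] V)) : halfMap A (0 : V →ₗ[ℤ] W) z = 0 := by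
  induction z using half_tensor_induction with
  | tmul x v r => simp
  | add z z' h h' => simp only [map_add, h, h', add_zero]

theorem applyForm_place (f : V →ₗ[ℤ] ℤ) (v : V) (y : Half A) :
    applyForm A f (place A v y) = f v • y := by
  induction y using TensorProduct.induction_on with
  | zero => simp
  | add y y' h h' => simp only [map_add, h, h', smul_add]
  | tmul x r => simp [TensorProduct.smul_tmul']

theorem halfMap_surjective {f : V →ₗ[ℤ] W} (hf : Function.Surjective f) :
    Function.Surjective (halfMap A f) :=
  LinearMap.rTensor_surjective _ (LinearMap.lTensor_surjective _ hf)

/-- A resolution of the identity of `V` remains one after tensoring. Hence the forms `f i` jointly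
detect elements of `(A ⊗ V)[1/2]`, even when `A` has torsion. -/
theorem sum_place_applyForm {ι : Type*} [Fintype ι] (v : ι → V) (f : ι → V →ₗ[ℤ] ℤ)
    (hvf : ∀ w, ∑ i, f i w • v i = w) (z : Half (A ⊗[ℤ] V)) :
    ∑ i, place A (v i) (applyForm A (f i) z) = z := by
  induction z using half_tensor_induction with
  | tmul x w r =>
    simp only [applyForm_tmul, place_tmul]
    rw [← TensorProduct.sum_tmul]
    simp only [TensorProduct.smul_tmul]
    rw [← TensorProduct.tmul_sum, hvf]
  | add z z' h h' => simp only [map_add, Finset.sum_add_distrib, h, h']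

/-- The element `1/2` of `ℤ[1/2]`. -/
def oneHalf : ZHalf := IsLocalization.Away.invSelf (2 : ℤ)

theorem two_mul_oneHalf : (2 : ZHalf) * oneHalf = 1 := by
  have := IsLocalization.Away.mul_invSelf (S := ZHalf) (2 : ℤ)
  rwa [map_ofNat] at this

theorem half_add_self_eq_zero {M : Type*} [AddCommGroup M] {y : Half M} (h : y + y = 0) :
    y = 0 := by
  have e : ∀ y : Half M, (LinearMap.mulLeft ℤ oneHalf).lTensor M (y + y) = y := by
    intro y
    induction y using TensorProduct.induction_on with
    | zero => simp
    | add y y' h h' => rw [add_add_add_comm, map_add, h, h']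
    | tmul x r =>
      have h2 : oneHalf * (r + r) = r := by linear_combination r * two_mul_oneHalf
      rw [← TensorProduct.tmul_add]
      simp [h2]
  rw [← e y, h, map_zero]

end HalfTensor

namespace ClosedComplex

variable {τ : Type*} (K : ClosedComplex τ)

/-! ## Flags -/

theorem move_zero_two (c : Flag τ) : K.move 0 (K.move 2 c) = K.move 2 (K.move 0 c) := by
  have h : Equiv.swap (1 : Fin 4) 2 3 = 3 := by decide
  simp [move, mul_assoc, h]

/-- Both sides multiply by the transposition of 1 and 3: three successive moves inside a triangle
reach the opposite flag either way. -/
theorem move_braid (c : Flag τ) :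
    K.move 0 (K.move 1 (K.move 0 c)) = K.move 1 (K.move 0 (K.move 1 c)) := by
  have h : Equiv.swap (1 : Fin 4) 2 * (Equiv.swap 2 3 * Equiv.swap 1 2)
      = Equiv.swap 2 3 * (Equiv.swap 1 2 * Equiv.swap 2 3) := by decide
  simp [move, mul_assoc, h]

/-- The involution `move a`, as a permutation. -/
def movePerm (a : Fin 3) : Equiv.Perm (Flag τ) :=
  Function.Involutive.toPerm (K.move a) (K.move_move a)

@[simp] theorem movePerm_apply (a : Fin 3) (c : Flag τ) : K.movePerm a c = K.move a c := rfl

/-- A one-dimensional cocycle with values in a group `A[1/2]` whose sums along all the loops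
vanish is a coboundary. -/
theorem exists_primitive [Finite τ] {A : Type*} [AddCommGroup A] (X : Fin 3 → Flag τ → Half A)
    (hX : ∀ a c, X a (K.move a c) = X a c) (hc : ∀ c, X 0 c - X 1 c + X 2 c = 0)
    (hl : ∀ γ : K.Loop, ∑ s ∈ Finset.range γ.length,
      (X 0 (γ.turn s) - X 0 (K.move 1 (γ.turn s))) = 0) :
    ∃ g : Fin 3 → Flag τ → Half A, (∀ a b, b ≠ a → ∀ c, g a (K.move b c) = g a c) ∧
      ∀ c, X 0 c = g 2 c - g 1 c ∧ X 1 c = g 2 c - g 0 c ∧ X 2 c = g 1 c - g 0 c := by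
  -- The two possible continuations of a loop: the next turn is around one or the other end of the
  -- side just crossed.
  let σ : Bool → Equiv.Perm (Flag τ) := fun i =>
    if i then K.movePerm 2 * K.movePerm 1 else K.movePerm 0 * (K.movePerm 2 * K.movePerm 1)
  obtain ⟨u, hu⟩ := exists_potential (σ := σ) (h := fun c => X 0 c - X 0 (K.move 1 c))
    (by
      intro n w hs hn
      refine hl ⟨n, w, fun a ha => ?_, hn⟩
      obtain ⟨i, hi⟩ := hs a ha
      cases i
      · exact Or.inr hi
      · exact Or.inl hi)
  have h1 : ∀ c, u (K.move 2 (K.move 1 c)) = u c + (X 0 c - X 0 (K.move 1 c)) :=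
    fun c => hu true c
  have h2 : ∀ c, u (K.move 0 (K.move 2 (K.move 1 c))) = u c + (X 0 c - X 0 (K.move 1 c)) :=
    fun c => hu false c
  have u0 : ∀ c, u (K.move 0 c) = u c := by
    intro c
    have e : c = K.move 2 (K.move 1 (K.move 1 (K.move 2 c))) := by simp [move_move]
    rw [e, h1, h2]
  -- The defect `u c - u (K.move 2 c)` compares the two directions of crossing a side. It is
  -- invariant under `move 0` and changes sign under `move 1`.
  have w0 : ∀ c, u (K.move 0 c) - u (K.move 2 (K.move 0 c)) = u c - u (K.move 2 c) := by
    intro c; rw [← move_zero_two, u0, u0]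
  have w1 : ∀ c, u (K.move 1 c) - u (K.move 2 (K.move 1 c)) = - (u c - u (K.move 2 c)) := by
    intro c
    have e1 := h1 c
    have e2 := h1 (K.move 1 c)
    rw [move_move] at e2
    rw [e1, e2]; abel
  -- In the braid relation one word contains `move 1` once and the other twice, so the defect equals
  -- its opposite. This is where 2 has to be invertible.
  have u2 : ∀ c, u (K.move 2 c) = u c := by
    intro c
    have e : u c - u (K.move 2 c) = - (u c - u (K.move 2 c)) := by
      have a1 := w0 (K.move 1 (K.move 0 c))
      rw [move_braid, w1, w0, w1, w1, w0, neg_neg] at a1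
      exact a1
    have e' : u c - u (K.move 2 c) = 0 :=
      half_add_self_eq_zero (by nth_rewrite 1 [e]; exact neg_add_cancel _)
    exact (sub_eq_zero.1 e').symm
  have g1 : ∀ c, X 0 (K.move 1 c) + u (K.move 1 c) = X 0 c + u c := by
    intro c
    have := h1 c
    rw [u2] at this
    rw [this]; abel
  have hc' : ∀ c, X 1 c = X 0 c + X 2 c := fun c => by
    have := hc c
    rw [sub_add_eq_add_sub, sub_eq_zero] at this
    exact this.symm
  -- `u` is the potential at midpoints of sides; the values at corners and centres are obtained from
  -- it by following the edges of the flag.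
  refine ⟨![fun c => u c - X 2 c, u, fun c => X 0 c + u c], ?_, fun c => ⟨?_, ?_, ?_⟩⟩
  · intro a b hb c
    fin_cases a <;> fin_cases b <;> first | exact absurd rfl hb | skip
    · have e1 := hc' c
      have e2 := hc' (K.move 1 c)
      rw [hX, e1] at e2
      have e3 : X 2 (K.move 1 c) = X 0 c + X 2 c - X 0 (K.move 1 c) := by rw [e2]; abel
      have e4 := eq_sub_of_add_eq' (g1 c)
      change u (K.move 1 c) - X 2 (K.move 1 c) = u c - X 2 c
      rw [e3, e4]; abel
    · change u (K.move 2 c) - X 2 (K.move 2 c) = u c - X 2 c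
      rw [hX, u2]
    · exact u0 c
    · exact u2 c
    · change X 0 (K.move 0 c) + u (K.move 0 c) = X 0 c + u c
      rw [hX, u0]
    · exact g1 c
  · simp
  · simp [hc' c]; abel
  · simp

/-! ## Joint injectivity of the evaluations on loops -/

section Evaluation

/-- The coordinates of a family of functions on flags. -/
def coord (i : Fin 3 × Flag τ × Fin 2) : FlagFun τ →ₗ[ℤ] ℤ where
  toFun x := x i.1 i.2.1 i.2.2
  map_add' _ _ := rfl
  map_smul' _ _ := rfl

@[simp] theorem coord_apply (i : Fin 3 × Flag τ × Fin 2) (x : FlagFun τ) :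
    coord i x = x i.1 i.2.1 i.2.2 := rfl

/-- The family of functions on flags with one coordinate equal to `1`. -/
def unitFun (i : Fin 3 × Flag τ × Fin 2) : FlagFun τ := fun a c j => by
  classical exact if i = (a, c, j) then 1 else 0

theorem sum_coord_smul_unitFun [Fintype τ] (x : FlagFun τ) :
    ∑ i, coord i x • unitFun i = x := by
  classical
  funext a c j
  simp only [Finset.sum_apply, Pi.smul_apply, coord_apply, unitFun, smul_eq_mul, mul_ite, mul_one,
    mul_zero]
  simp

theorem d0_mem_Z1 {g : FlagFun τ} (hg : g ∈ K.C0) : d0 g ∈ K.Z1 := by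
  refine ⟨fun a c => ?_, fun c => ?_⟩
  · fin_cases a
    · exact congrArg₂ (· - ·) (hg 2 0 (by decide) c) (hg 1 0 (by decide) c)
    · exact congrArg₂ (· - ·) (hg 2 1 (by decide) c) (hg 0 1 (by decide) c)
    · exact congrArg₂ (· - ·) (hg 1 2 (by decide) c) (hg 0 2 (by decide) c)
  · change (g 2 c - g 1 c) - (g 2 c - g 0 c) + (g 1 c - g 0 c) = 0
    abel

/-- The coboundary as a map from cochains to cocycles. -/
def coboundary : K.C0 →ₗ[ℤ] K.Z1 :=
  (d0.comp K.C0.subtype).codRestrict K.Z1 fun g => K.d0_mem_Z1 g.2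

/-- The class of a cocycle. -/
def toH1 : K.Z1 →ₗ[ℤ] K.H1 := (K.B1.comap K.Z1.subtype).mkQ

theorem toH1_comp_coboundary : K.toH1 ∘ₗ K.coboundary = 0 := by
  ext g : 1
  exact (Submodule.Quotient.mk_eq_zero _).2 ⟨g, g.2, rfl⟩

/-- The linear map whose kernel is the module of cocycles. -/
def cocycleDefect : FlagFun τ →ₗ[ℤ] FlagFun τ × (Flag τ → Fin 2 → ℤ) where
  toFun x := (fun a c => x a (K.move a c) - x a c, fun c => x 0 c - x 1 c + x 2 c)
  map_add' x y := by
    refine Prod.ext (funext fun a => funext fun c => ?_) (funext fun c => ?_) <;>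
      simp only [Pi.add_apply, Prod.mk_add_mk] <;> abel
  map_smul' r x := by
    refine Prod.ext (funext fun a => funext fun c => ?_) (funext fun c => ?_) <;>
      simp <;> ring

theorem ker_cocycleDefect : LinearMap.ker K.cocycleDefect = K.Z1 := by
  ext x
  simp only [LinearMap.mem_ker, cocycleDefect, LinearMap.coe_mk, AddHom.coe_mk, Prod.mk_eq_zero,
    funext_iff (g := (0 : FlagFun τ)), funext_iff (g := (0 : Flag τ → Fin 2 → ℤ))]
  refine and_congr (forall_congr' fun a => ?_) Iff.rfl
  rw [funext_iff]
  exact forall_congr' fun c => sub_eq_zero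

/-- The image of `cocycleDefect` is a subgroup of a free abelian group of finite rank, hence free,
so its kernel `Z1` splits off. -/
theorem exists_retraction_Z1 [Finite τ] :
    ∃ r : FlagFun τ →ₗ[ℤ] K.Z1, ∀ x : K.Z1, r x = x := by
  obtain ⟨s, hs⟩ := LinearMap.exists_rightInverse_of_surjective K.cocycleDefect.rangeRestrict
    (LinearMap.range_rangeRestrict _)
  have hs' : ∀ y, K.cocycleDefect (s y) = y := fun y =>
    congrArg Subtype.val (LinearMap.congr_fun hs y)
  refine ⟨(LinearMap.id - s ∘ₗ K.cocycleDefect.rangeRestrict).codRestrict K.Z1 fun x => ?_,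
    fun x => Subtype.ext ?_⟩
  swap
  · refine K.ker_cocycleDefect.le (LinearMap.mem_ker.2 ?_)
    simp [hs']
  · have hx : K.cocycleDefect.rangeRestrict x = 0 :=
      Subtype.ext (LinearMap.mem_ker.1 (K.ker_cocycleDefect.ge x.2))
    simp [hx]

/-- The cell of dimension `a` of a flag. -/
def cell (a : Fin 3) (c : Flag τ) : K.LinkCell a := Quot.mk _ c

theorem cell_move {a b : Fin 3} (hb : b ≠ a) (c : Flag τ) : K.cell a (K.move b c) = K.cell a c :=
  (Quot.sound ⟨b, hb, rfl⟩).symm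

/-- The cochain of degree `0` with value `1` at one cell and `0` at the others. -/
def cellFun (a : Fin 3) (s : K.LinkCell a) (j : Fin 2) : K.C0 :=
  ⟨fun a' c j' => (Set.indicator {(⟨a, s⟩, j)} 1 : (Σ a, K.LinkCell a) × Fin 2 → ℤ)
    (⟨a', K.cell a' c⟩, j'), by
    intro a' b hb c
    simp only [K.cell_move hb]⟩

theorem evalClass_toH1 {K : ClosedComplex τ} (γ : K.Loop) (l : Fin 2 → ℤ) :
    evalClass γ l ∘ₗ K.toH1 = (l 0 • evalCochain γ 0 + l 1 • evalCochain γ 1) ∘ₗ K.Z1.subtype :=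
  rfl

/-- The coordinates of a lift to `Z1` form a cocycle with values in `A[1/2]`, to which
`exists_primitive` applies. Its primitive is reassembled into a tensor over `C0`, whose coboundary
is the lift. -/
theorem eq_zero_of_evalClass [Fintype τ] {A : Type*} [AddCommGroup A] (z : Half (A ⊗[ℤ] K.H1))
    (hz : ∀ (γ : K.Loop) (n m : ℤ), applyForm A (evalClass γ ![n, m]) z = 0) : z = 0 := by
  classical
  obtain ⟨y, rfl⟩ := halfMap_surjective (A := A) (f := K.toH1) (Submodule.mkQ_surjective _) z
  let X : Fin 2 → Fin 3 → Flag τ → Half A :=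
    fun j a c => applyForm A (coord (a, c, j) ∘ₗ K.Z1.subtype) y
  have hg : ∀ j, ∃ g : Fin 3 → Flag τ → Half A, (∀ a b, b ≠ a → ∀ c, g a (K.move b c) = g a c) ∧
      ∀ c, X j 0 c = g 2 c - g 1 c ∧ X j 1 c = g 2 c - g 0 c ∧ X j 2 c = g 1 c - g 0 c := by
    intro j
    refine K.exists_primitive (X j) (fun a c => ?_) (fun c => ?_) (fun γ => ?_)
    · refine congrArg (fun f => applyForm A f y) (LinearMap.ext fun x => ?_)
      exact congrFun (x.2.1 a c) j
    · simp only [X]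
      rw [← applyForm_sub, ← applyForm_add]
      convert applyForm_zero y
      ext x : 1
      exact congrFun (x.2.2 c) j
    · simp only [X, ← applyForm_sub, ← applyForm_sum]
      have := hz γ (if j = 0 then 1 else 0) (if j = 1 then 1 else 0)
      rw [applyForm_halfMap, evalClass_toH1] at this
      rw [← this]
      refine congrArg (fun f => applyForm A f y) (LinearMap.ext fun x => ?_)
      fin_cases j <;> simp [evalCochain]
  choose g hg hX using hg
  let gq : (j : Fin 2) → (a : Fin 3) → K.LinkCell a → Half A := fun j a =>
    Quot.lift (g j a) (by rintro c d ⟨b, hb, rfl⟩; exact (hg j a b hb c).symm)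
  have : Finite (Σ a, K.LinkCell a) := by
    have : ∀ a, Finite (K.LinkCell a) := fun a => Quot.finite _
    infer_instance
  have := Fintype.ofFinite (Σ a, K.LinkCell a)
  let y' : Half (A ⊗[ℤ] K.C0) :=
    ∑ p : (Σ a, K.LinkCell a) × Fin 2, place A (K.cellFun p.1.1 p.1.2 p.2) (gq p.2 p.1.1 p.1.2)
  have hy' : ∀ a c j, applyForm A (coord (a, c, j) ∘ₗ K.C0.subtype) y' = g j a c := by
    intro a c j
    simp only [y', map_sum, applyForm_place]
    rw [Finset.sum_eq_single (⟨⟨a, K.cell a c⟩, j⟩ : (Σ a, K.LinkCell a) × Fin 2)]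
    · simp [cellFun, gq, cell]
    · rintro ⟨⟨a', s⟩, j'⟩ - hne
      have : ((⟨a, K.cell a c⟩, j) : (Σ a, K.LinkCell a) × Fin 2) ∉
          ({(⟨a', s⟩, j')} : Set ((Σ a, K.LinkCell a) × Fin 2)) := fun h => hne h.symm
      simp only [LinearMap.comp_apply, Submodule.subtype_apply, coord_apply, cellFun,
        Set.indicator_of_notMem this, zero_smul]
    · simp
  obtain ⟨r, hr⟩ := K.exists_retraction_Z1
  -- By the retraction onto `Z1`, the coordinate forms and the images of the unit functions resolve
  -- the identity of `Z1`; equality can be checked on coordinates.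
  have key : halfMap A K.coboundary y' = y := by
    have hrec : ∀ w : K.Z1, ∑ i : Fin 3 × Flag τ × Fin 2,
        (coord i ∘ₗ K.Z1.subtype) w • r (unitFun i) = w := by
      intro w
      have := congrArg r (sum_coord_smul_unitFun (w : FlagFun τ))
      simp only [hr, map_sum, map_smul] at this
      exact this
    rw [← sum_place_applyForm _ _ hrec y, ← sum_place_applyForm _ _ hrec (halfMap A K.coboundary y')]
    refine Finset.sum_congr rfl fun i _ => congrArg _ ?_
    obtain ⟨a, c, j⟩ := i
    rw [applyForm_halfMap]
    have hc : ∀ a b : Fin 3, ∀ x : Half (A ⊗[ℤ] K.C0),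
        applyForm A (coord (a, c, j) ∘ₗ K.C0.subtype) x
          - applyForm A (coord (b, c, j) ∘ₗ K.C0.subtype) x
        = applyForm A ((coord (a, c, j) - coord (b, c, j)) ∘ₗ K.C0.subtype) x :=
      fun a b x => (applyForm_sub _ _ x).symm
    fin_cases a
    · refine Eq.trans ?_ (hX j c).1.symm
      rw [← hy', ← hy', hc]; rfl
    · refine Eq.trans ?_ (hX j c).2.1.symm
      rw [← hy', ← hy', hc]; rfl
    · refine Eq.trans ?_ (hX j c).2.2.symm
      rw [← hy', ← hy', hc]; rfl
  rw [← key, halfMap_halfMap, toH1_comp_coboundary, halfMap_zero]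

end Evaluation

/-! ## Cocycles with given values on turns -/

theorem orient_eq (c : Flag τ) : orient c = 1 ∨ orient c = -1 := by
  rcases Int.units_eq_one_or (Equiv.Perm.sign c.2) with h | h <;> simp [orient, h]

/-- A side of each triangle of the links, given by the opposite corner. -/
def baseSide (i : Fin 4) : Fin 4 := if i = 0 then 1 else 0

theorem baseSide_cases : ∀ π : Equiv.Perm (Fin 4),
    π 3 = baseSide (π 0) ∨ π 2 = baseSide (π 0) ∨ π 1 = baseSide (π 0) := by
  decide

/-- An antisymmetric function on turns, the sums of which around the triangles and around the
corners vanish, comes from a cocycle. -/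
theorem exists_cocycle [Finite τ] (h : Flag τ → Fin 2 → ℤ) (h1 : ∀ c, h (K.move 1 c) = - h c)
    (htri : ∀ c, h c + h (K.move 0 (K.move 1 c)) = h (K.move 0 c))
    (hcor : ∀ (n : ℕ) (w : ℕ → Flag τ), (∀ a < n, w (a + 1) = K.move 2 (K.move 1 (w a))) →
      w n = w 0 → ∑ a ∈ Finset.range n, h (w a) = 0) :
    ∃ x ∈ K.Z1, ∀ c, x 0 c - x 0 (K.move 1 c) = h c := by
  -- Potential for the rotation of flags around a corner. Rotation preserves the orientation sign,
  -- so `P` uses `u` on positive flags and transports it to negative ones by `move 2`.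
  obtain ⟨u, hu⟩ := exists_potential (σ := fun _ : Unit => K.movePerm 2 * K.movePerm 1) (h := h)
    (fun n w hs hn => hcor n w (fun a ha => (hs a ha).elim fun _ e => e) hn)
  replace hu : ∀ c, u (K.move 2 (K.move 1 c)) = u c + h c := hu ()
  let P : Flag τ → Fin 2 → ℤ := fun c => if orient c = 1 then u c else u (K.move 2 c)
  have P2 : ∀ c, P (K.move 2 c) = P c := by
    intro c
    rcases orient_eq c with e | e <;> simp [P, orient_move, e, move_move]
  have P1 : ∀ c, P (K.move 1 c) = P c + h c := by
    intro c
    rcases orient_eq c with e | e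
    · simp [P, orient_move, e, hu]
    · have := hu (K.move 1 c)
      rw [move_move, h1] at this
      simp [P, orient_move, e, this]
  -- `Q` is normalised to vanish on the base side of each triangle. On another side it is the value
  -- of `h` on the turn from that side to the base side, around the corner that they share.
  let Q : Flag τ → Fin 2 → ℤ := fun c =>
    if c.2 3 = baseSide (c.2 0) then 0
    else if c.2 2 = baseSide (c.2 0) then h c else h (K.move 0 c)
  have s1 : Equiv.swap (1 : Fin 4) 2 3 = 3 := by decide
  have s2 : Equiv.swap (1 : Fin 4) 2 0 = 0 := by decide
  have s3 : Equiv.swap (2 : Fin 4) 3 0 = 0 := by decide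
  have s4 : Equiv.swap (2 : Fin 4) 3 1 = 1 := by decide
  have Q0 : ∀ c, Q (K.move 0 c) = Q c := by
    intro c
    have e0 : (K.move 0 c).2 0 = c.2 0 := by simp [move, s2]
    have e1 : (K.move 0 c).2 3 = c.2 3 := by simp [move, s1]
    have e2 : (K.move 0 c).2 2 = c.2 1 := by simp [move]
    simp only [Q, e0, e1, e2, move_move]
    by_cases a3 : c.2 3 = baseSide (c.2 0)
    · simp [a3]
    · rcases baseSide_cases c.2 with b | b | b
      · exact absurd b a3
      · have : c.2 1 ≠ baseSide (c.2 0) := fun e =>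
          absurd (c.2.injective (e.trans b.symm)) (by decide)
        simp [a3, b, this]
      · have : c.2 2 ≠ baseSide (c.2 0) := fun e =>
          absurd (c.2.injective (e.trans b.symm)) (by decide)
        simp [a3, b, this]
  have Q1 : ∀ c, Q c - Q (K.move 1 c) = h c := by
    intro c
    have e0 : (K.move 1 c).2 0 = c.2 0 := by simp [move, s3]
    have e1 : (K.move 1 c).2 3 = c.2 2 := by simp [move]
    have e2 : (K.move 1 c).2 2 = c.2 3 := by simp [move]
    simp only [Q, e0, e1, e2, h1]
    rcases baseSide_cases c.2 with b | b | b
    · have : c.2 2 ≠ baseSide (c.2 0) := fun e =>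
        absurd (c.2.injective (e.trans b.symm)) (by decide)
      simp [b, this]
    · have : c.2 3 ≠ baseSide (c.2 0) := fun e =>
        absurd (c.2.injective (e.trans b.symm)) (by decide)
      simp [b, this]
    · have n3 : c.2 3 ≠ baseSide (c.2 0) := fun e =>
        absurd (c.2.injective (e.trans b.symm)) (by decide)
      have n2 : c.2 2 ≠ baseSide (c.2 0) := fun e =>
        absurd (c.2.injective (e.trans b.symm)) (by decide)
      simp only [n3, n2, if_false]
      rw [← htri c]; abel
  refine ⟨![Q, fun c => Q c + P c, P], ⟨fun a c => ?_, fun c => ?_⟩, Q1⟩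
  · fin_cases a
    · exact Q0 c
    · change Q (K.move 1 c) + P (K.move 1 c) = Q c + P c
      rw [P1, ← Q1 c]; abel
    · exact P2 c
  · change Q c - (Q c + P c) + P c = 0
    abel

/-! ## Values of decorations -/

/-- The value of a linear form on `J²` at an oriented edge, and zero if the ends are equal. -/
def edgeVal (x : Module.Dual ℤ (J2 τ)) (t : τ) (i j : Fin 4) : ℤ :=
  if h : i ≠ j then x (basisVec t (Sum.inl ⟨(i, j), h⟩)) else 0

/-- The value of a linear form on `J²` at the face opposite to a vertex. -/
def faceVal (x : Module.Dual ℤ (J2 τ)) (t : τ) (l : Fin 4) : ℤ := x (basisVec t (Sum.inr l))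

/-- In multiplicative form, the relation `z_{ij} z_{ik} z_{il} = 1` satisfied on `J*`. -/
theorem sum_eps_edge : ∀ (α : TetIndex) (i : Fin 4),
    ∑ j : Fin 4, (if h : i ≠ j then eps α (Sum.inl ⟨(i, j), h⟩) else 0) = 0 := by
  decide +kernel

/-- In multiplicative form, `z_{ijk} = z_{il} z_{jl} z_{kl}`: edge coordinates determine the face
coordinates. -/
theorem eps_face_eq : ∀ (α : TetIndex) (l : Fin 4),
    eps α (Sum.inr l) = ∑ i : Fin 4, if h : i ≠ l then eps α (Sum.inl ⟨(i, l), h⟩) else 0 := by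
  decide +kernel

theorem edgeVal_Omega2 [Fintype τ] (v : J2 τ) (t : τ) (i j : Fin 4) :
    edgeVal (Omega2 τ v) t i j
      = ∑ α, (if h : i ≠ j then eps α (Sum.inl ⟨(i, j), h⟩) else 0) * v (t, α) := by
  unfold edgeVal
  split_ifs with h
  · exact Omega2_basisVec τ v t _
  · simp

theorem sum_edgeVal [Fintype τ] {x : Module.Dual ℤ (J2 τ)} (hx : x ∈ JStar τ) (t : τ)
    (i : Fin 4) : ∑ j, edgeVal x t i j = 0 := by
  obtain ⟨v, rfl⟩ := hx
  simp only [edgeVal_Omega2]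
  rw [Finset.sum_comm]
  simp only [← Finset.sum_mul, sum_eps_edge, zero_mul, Finset.sum_const_zero]

theorem faceVal_eq [Fintype τ] {x : Module.Dual ℤ (J2 τ)} (hx : x ∈ JStar τ) (t : τ)
    (l : Fin 4) : faceVal x t l = ∑ i, edgeVal x t i l := by
  obtain ⟨v, rfl⟩ := hx
  simp only [edgeVal_Omega2, faceVal, Omega2_basisVec]
  rw [Finset.sum_comm]
  simp only [← Finset.sum_mul, ← eps_face_eq]

theorem edgeVal_of_eq (x : Module.Dual ℤ (J2 τ)) (t : τ) (i : Fin 4) : edgeVal x t i i = 0 := by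
  simp [edgeVal]

/-- Twice the additive holonomy of turns, with the contributions of the faces distributed
between the two ends of each turn, so that it is antisymmetric. -/
def turnVal (x : Module.Dual ℤ (J2 τ)) (c : Flag τ) : Fin 2 → ℤ :=
  ![orient c * (2 * edgeVal x c.1 (c.2 1) (c.2 0)
      + faceVal x c.1 (c.2 2) + faceVal x c.1 (c.2 3)),
    orient c * (2 * edgeVal x c.1 (c.2 0) (c.2 1))]

theorem turnVal_move_one (x : Module.Dual ℤ (J2 τ)) (c : Flag τ) :
    turnVal x (K.move 1 c) = - turnVal x c := by
  have s3 : Equiv.swap (2 : Fin 4) 3 0 = 0 := by decide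
  have s4 : Equiv.swap (2 : Fin 4) 3 1 = 1 := by decide
  have ho := K.orient_move 1 c
  funext a
  fin_cases a <;> simp [turnVal, ho] <;> simp [move, s3, s4]
  exact Or.inl (by ring)

theorem sum_perm_four {M : Type*} [AddCommMonoid M] (f : Fin 4 → M) (π : Equiv.Perm (Fin 4)) :
    ∑ i, f i = f (π 0) + f (π 1) + f (π 2) + f (π 3) := by
  rw [← Equiv.sum_comp π, Fin.sum_univ_four]

/-- The three turns in one sense around the triangle of `i` add up, up to a common sign, to twice
the sum of the `z_{ij}` for `C`, and to twice the sum of all edge values of the tetrahedron for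
`C*`. Both vanish on `J*`. -/
theorem turnVal_triangle [Fintype τ] {x : Module.Dual ℤ (J2 τ)} (hx : x ∈ JStar τ)
    (c : Flag τ) :
    turnVal x c + turnVal x (K.move 0 (K.move 1 c)) = turnVal x (K.move 0 c) := by
  obtain ⟨t, π⟩ := c
  have a3 : Equiv.swap (2 : Fin 4) 3 0 = 0 := by decide
  have a4 : Equiv.swap (2 : Fin 4) 3 1 = 1 := by decide
  have a1 : Equiv.swap (1 : Fin 4) 2 0 = 0 := by decide
  have a2 : Equiv.swap (1 : Fin 4) 2 3 = 3 := by decide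
  have o1 : orient (K.move 0 (K.move 1 (t, π))) = orient (t, π) := by simp [orient_move]
  have o2 : orient (K.move 0 (t, π)) = - orient (t, π) := K.orient_move 0 _
  have r := fun i => (sum_perm_four _ π).symm.trans (sum_edgeVal hx t i)
  have f := fun l => (faceVal_eq hx t l).trans (sum_perm_four _ π)
  have d := edgeVal_of_eq x t
  have r0 := r (π 0)
  have r1 := r (π 1)
  have r2 := r (π 2)
  have r3 := r (π 3)
  simp only [d] at r0 r1 r2 r3
  funext a
  fin_cases a
  · simp [turnVal, o1, o2]
    simp [move, a1, a2, a3, a4]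
    have f0 := f (π 0)
    have f1 := f (π 1)
    have f2 := f (π 2)
    have f3 := f (π 3)
    simp only [d] at f0 f1 f2 f3
    linear_combination orient (t, π) * (2 * f1 + 2 * f2 + 2 * f3 + 2 * r0 + 2 * r1 + 2 * r2 + 2 * r3)
  · simp [turnVal, o1, o2]
    simp [move, a1, a3]
    linear_combination 2 * orient (t, π) * r0

/-- The oriented edge of a flag. -/
def flagEdge (c : Flag τ) : TetEdge :=
  ⟨(c.2 0, c.2 1), fun h => absurd (c.2.injective h) (by decide)⟩

theorem perm_ext_of_sign : ∀ π ρ : Equiv.Perm (Fin 4), Equiv.Perm.sign π = Equiv.Perm.sign ρ →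
    π 0 = ρ 0 → π 1 = ρ 1 → π = ρ := by
  decide +kernel

theorem exists_perm_of_sign : ∀ (s : ℤˣ) (i j : Fin 4), i ≠ j →
    ∃ π : Equiv.Perm (Fin 4), Equiv.Perm.sign π = s ∧ π 0 = i ∧ π 1 = j := by
  decide +kernel

theorem flag_ext {c d : Flag τ} (ho : orient c = orient d) (ht : c.1 = d.1)
    (he : flagEdge c = flagEdge d) : c = d := by
  have h := congrArg Subtype.val he
  exact Prod.ext ht (perm_ext_of_sign _ _ (Units.ext ho) (congrArg Prod.fst h)
    (congrArg Prod.snd h))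

theorem exists_flag (c : Flag τ) (t : τ) (e : TetEdge) :
    ∃ d : Flag τ, orient d = orient c ∧ d.1 = t ∧ flagEdge d = e := by
  obtain ⟨π, h, h0, h1⟩ := exists_perm_of_sign (Equiv.Perm.sign c.2) e.1.1 e.1.2 e.2
  exact ⟨(t, π), congrArg Units.val h, rfl, Subtype.ext (Prod.ext h0 h1)⟩

theorem flagEdge_move_one (c : Flag τ) : flagEdge (K.move 1 c) = flagEdge c := by
  have s3 : Equiv.swap (2 : Fin 4) 3 0 = 0 := by decide
  have s4 : Equiv.swap (2 : Fin 4) 3 1 = 1 := by decide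
  simp [flagEdge, move, s3, s4]

/-- A vector with equal entries on identified cells is in the image of `F`, where elements of `Ker
F*` vanish. -/
theorem eq_zero_of_constant {x : Module.Dual ℤ (J2 τ)} (hx : x ∈ LinearMap.ker K.F.dualMap)
    (v : J2 τ) (hv : ∀ p q, K.CellRel p q → v p = v q) : x v = 0 :=
  LinearMap.congr_fun (LinearMap.mem_ker.1 hx) (Quot.lift v hv : K.Cell → ℤ)

theorem faceVal_move_two {x : Module.Dual ℤ (J2 τ)} (hx : x ∈ LinearMap.ker K.F.dualMap)
    (t : τ) (l : Fin 4) : faceVal x (K.tet t l) (K.perm t l l) = - faceVal x t l := by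
  classical
  -- The gluing is an involution on faces, so the sum of the two basis vectors is constant on cells.
  have h := K.eq_zero_of_constant hx
    (basisVec t (Sum.inr l) + basisVec (K.tet t l) (Sum.inr (K.perm t l l))) (by
      rintro _ _ (⟨s, e, m, h1, h2⟩ | ⟨s, m⟩)
      · simp [basisVec]
      · have h1 : (K.tet s m = t ∧ K.perm s m m = l) ↔
            (s = K.tet t l ∧ m = K.perm t l l) := by
          constructor
          · rintro ⟨rfl, rfl⟩
            simp [K.tet_tet, K.perm_perm]
          · rintro ⟨rfl, rfl⟩
            simp [K.tet_tet, K.perm_perm]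
        have h2 : (K.tet s m = K.tet t l ∧ K.perm s m m = K.perm t l l) ↔ (s = t ∧ m = l) := by
          constructor
          · rintro ⟨e1, e2⟩
            have a1 := K.tet_tet s m
            have a2 := K.perm_perm s m
            rw [e1, e2] at a1 a2
            rw [K.tet_tet] at a1
            rw [K.perm_perm] at a2
            refine ⟨a1.symm, ?_⟩
            have a3 := inv_injective a2
            rw [← a3] at e2
            exact (K.perm t l).injective e2
          · rintro ⟨rfl, rfl⟩
            simp
        simp only [Pi.add_apply, basisVec, Prod.mk.injEq, Sum.inr.injEq, h1, h2]
        rw [add_comm])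
  rw [map_add] at h
  exact eq_neg_of_add_eq_zero_right h

/-- The sum of the values of a decoration around an edge of `K` vanishes. -/
theorem sum_edge_eq_zero {x : Module.Dual ℤ (J2 τ)} (hx : x ∈ LinearMap.ker K.F.dualMap)
    (n : ℕ) (w : ℕ → Flag τ) (hw : ∀ a < n, w (a + 1) = K.move 2 (K.move 1 (w a)))
    (hn : w n = w 0) :
    ∑ a ∈ Finset.range n, x (basisVec (w a).1 (Sum.inl (flagEdge (w a)))) = 0 := by
  classical
  rw [← map_sum]
  refine K.eq_zero_of_constant hx _ ?_
  have ho : ∀ a ≤ n, orient (w a) = orient (w 0) := by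
    intro a
    induction a with
    | zero => intro _; rfl
    | succ a ih => intro ha; rw [hw a ha, orient_move, orient_move, neg_neg, ih (by omega)]
  -- A flag is determined by its sign, tetrahedron and oriented edge, so the entry of the vector at
  -- an edge counts the visits of the walk to one flag.
  have val : ∀ d : Flag τ, orient d = orient (w 0) →
      (∑ a ∈ Finset.range n, basisVec (w a).1 (Sum.inl (flagEdge (w a)))) (d.1,
        Sum.inl (flagEdge d)) = ∑ a ∈ Finset.range n, if w a = d then 1 else 0 := by
    intro d hd
    rw [Finset.sum_apply]
    refine Finset.sum_congr rfl fun a ha => if_congr ?_ rfl rfl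
    rw [Prod.mk.injEq, Sum.inl.injEq]
    constructor
    · rintro ⟨e1, e2⟩
      exact flag_ext ((ho a (Finset.mem_range.1 ha).le).trans hd.symm) e1.symm e2.symm
    · rintro rfl
      exact ⟨rfl, rfl⟩
  -- The closed walk visits a flag and its rotated image equally often. Crossing either of the two
  -- faces containing the edge is a rotation or its inverse, so the vector is constant on cells.
  have shift : ∀ d : Flag τ,
      (∑ a ∈ Finset.range n, if w a = K.move 2 (K.move 1 d) then 1 else 0 : ℤ)
        = ∑ a ∈ Finset.range n, if w a = d then 1 else 0 := by
    intro d
    have e1 := Finset.sum_range_succ (fun a => if w a = K.move 2 (K.move 1 d) then (1 : ℤ) else 0) n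
    rw [Finset.sum_range_succ', hn] at e1
    rw [← add_right_cancel e1]
    refine Finset.sum_congr rfl fun a ha => if_congr ?_ rfl rfl
    rw [hw a (Finset.mem_range.1 ha)]
    exact ((K.movePerm 2 * K.movePerm 1).injective.eq_iff : _ ↔ w a = d)
  rintro _ _ (⟨t, e, m, h1, h2⟩ | ⟨t, l⟩)
  · obtain ⟨d, hd, rfl, rfl⟩ := exists_flag (w 0) t e
    have hm : m = d.2 2 ∨ m = d.2 3 := by
      obtain ⟨i, rfl⟩ := d.2.surjective m
      fin_cases i
      · exact absurd rfl h1
      · exact absurd rfl h2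
      · exact Or.inl rfl
      · exact Or.inr rfl
    have s3 : Equiv.swap (2 : Fin 4) 3 0 = 0 := by decide
    have s4 : Equiv.swap (2 : Fin 4) 3 1 = 1 := by decide
    rw [val d hd]
    rcases hm with rfl | rfl
    · rw [← shift, ← val _ (by rw [orient_move, orient_move, neg_neg, hd])]
      rfl
    · have e : d = K.move 2 (K.move 1 (K.move 1 (K.move 2 d))) := by simp [move_move]
      conv_lhs => rw [e]
      rw [shift, ← val _ (by rw [orient_move, orient_move, neg_neg, hd]), flagEdge_move_one]
      rfl
  · simp [basisVec]

end ClosedComplex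

/-! ## The local identity -/

theorem sum_sign_perm_four (f : Fin 4 → Fin 4 → Fin 4 → Fin 4 → ℤ) :
    ∑ π : Equiv.Perm (Fin 4), (Equiv.Perm.sign π : ℤ) * f (π 0) (π 1) (π 2) (π 3)
      = f 0 1 2 3 - f 0 1 3 2 + f 0 2 3 1 - f 0 2 1 3 + f 0 3 1 2 - f 0 3 2 1
        + f 1 0 3 2 - f 1 0 2 3 + f 1 3 2 0 - f 1 3 0 2 + f 1 2 0 3 - f 1 2 3 0
        + f 2 3 0 1 - f 2 3 1 0 + f 2 0 1 3 - f 2 0 3 1 + f 2 1 3 0 - f 2 1 0 3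
        + f 3 2 1 0 - f 3 2 0 1 + f 3 1 0 2 - f 3 1 2 0 + f 3 0 2 1 - f 3 0 1 2 := by
  -- Listing the signed permutations as explicit tuples keeps `f` out of the decision procedure.
  have e : (Finset.univ : Finset (Equiv.Perm (Fin 4))).val.map
      (fun π => ((Equiv.Perm.sign π : ℤ), π 0, π 1, π 2, π 3))
      = {(1, 0, 1, 2, 3), (-1, 0, 1, 3, 2), (1, 0, 2, 3, 1), (-1, 0, 2, 1, 3), (1, 0, 3, 1, 2),
         (-1, 0, 3, 2, 1), (1, 1, 0, 3, 2), (-1, 1, 0, 2, 3), (1, 1, 3, 2, 0), (-1, 1, 3, 0, 2),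
         (1, 1, 2, 0, 3), (-1, 1, 2, 3, 0), (1, 2, 3, 0, 1), (-1, 2, 3, 1, 0), (1, 2, 0, 1, 3),
         (-1, 2, 0, 3, 1), (1, 2, 1, 3, 0), (-1, 2, 1, 0, 3), (1, 3, 2, 1, 0), (-1, 3, 2, 0, 1),
         (1, 3, 1, 0, 2), (-1, 3, 1, 2, 0), (1, 3, 0, 2, 1), (-1, 3, 0, 1, 2)} := by
    decide +kernel
  have h := congrArg (fun s => (s.map fun p : ℤ × Fin 4 × Fin 4 × Fin 4 × Fin 4 =>
    p.1 * f p.2.1 p.2.2.1 p.2.2.2.1 p.2.2.2.2).sum) e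
  simp only [Multiset.map_map, Function.comp_def] at h
  refine h.trans ?_
  simp only [Multiset.insert_eq_cons, Multiset.map_cons, Multiset.map_singleton,
    Multiset.sum_cons, Multiset.sum_singleton]
  ring

/-- The local contribution of a flag to six times the cup product. -/
def localTerm (X Y : Fin 4 → Fin 4 → ℤ) (F G : Fin 4 → ℤ) (i j k l : Fin 4) : ℤ :=
  - ((2 * X j i + F k + F l) *
      (2 * (2 * Y j i - 2 * Y k i + G k - G j) - 4 * (Y j i - Y j k)
        + 2 * (Y i j - Y i k) - (2 * Y i j - 2 * Y k j + G k - G i) - 3 * G l))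
    - 2 * F l * (4 * (Y j i - Y j k) + 2 * Y i j - 2 * Y k j + G k - G i)

/-- The relations leave two free edge values per vertex for `X` and for `Y`, and the rest is a
polynomial identity. The constant is `72 = 2 * 3 * 12`: 2 from `two_threeCup`, 3 from the
normalisation in `threeCup_eq`, 12 from the claim proved there. -/
theorem sum_localTerm (X Y : Fin 4 → Fin 4 → ℤ) (F G : Fin 4 → ℤ)
    (hX : ∀ i, ∑ j, X i j = 0) (hY : ∀ i, ∑ j, Y i j = 0)
    (dX : ∀ i, X i i = 0) (dY : ∀ i, Y i i = 0)
    (hF : ∀ l, F l = ∑ i, X i l) (hG : ∀ l, G l = ∑ i, Y i l) :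
    ∑ π : Equiv.Perm (Fin 4), (Equiv.Perm.sign π : ℤ) *
      localTerm X Y F G (π 0) (π 1) (π 2) (π 3)
    = 72 * ∑ i : Fin 4,
      (X (edgeA i).1.1 (edgeA i).1.2 * Y (edgeB i).1.1 (edgeB i).1.2
        - X (edgeB i).1.1 (edgeB i).1.2 * Y (edgeA i).1.1 (edgeA i).1.2) := by
  refine (sum_sign_perm_four (localTerm X Y F G)).trans ?_
  simp only [Fin.sum_univ_four] at *
  have x0 : X 0 3 = - X 0 1 - X 0 2 := by linear_combination hX 0 - dX 0
  have x1 : X 1 2 = - X 1 0 - X 1 3 := by linear_combination hX 1 - dX 1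
  have x2 : X 2 1 = - X 2 0 - X 2 3 := by linear_combination hX 2 - dX 2
  have x3 : X 3 0 = - X 3 1 - X 3 2 := by linear_combination hX 3 - dX 3
  have y0 : Y 0 3 = - Y 0 1 - Y 0 2 := by linear_combination hY 0 - dY 0
  have y1 : Y 1 2 = - Y 1 0 - Y 1 3 := by linear_combination hY 1 - dY 1
  have y2 : Y 2 1 = - Y 2 0 - Y 2 3 := by linear_combination hY 2 - dY 2
  have y3 : Y 3 0 = - Y 3 1 - Y 3 2 := by linear_combination hY 3 - dY 3
  simp only [localTerm, hF, hG, dX, dY, x0, x1, x2, x3, y0, y1, y2, y3]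
  simp only [edgeA, edgeB, Matrix.cons_val]
  ring

namespace ClosedComplex

variable {τ : Type*} (K : ClosedComplex τ)

/-! ## The other end of an edge -/

/-- The flag at the other end of the edge of a flag. -/
def flipEnds (c : Flag τ) : Flag τ := (c.1, c.2 * Equiv.swap 0 1)

theorem flipEnds_flipEnds (c : Flag τ) : flipEnds (flipEnds c) = c := by
  simp [flipEnds, mul_assoc]

theorem orient_flipEnds (c : Flag τ) : orient (flipEnds c) = - orient c := by
  have h : Equiv.Perm.sign (Equiv.swap (0 : Fin 4) 1) = -1 := by decide
  simp [flipEnds, orient, h]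

theorem flipEnds_move_one (c : Flag τ) : flipEnds (K.move 1 c) = K.move 1 (flipEnds c) := by
  have h : Equiv.swap (2 : Fin 4) 3 * Equiv.swap 0 1 = Equiv.swap 0 1 * Equiv.swap 2 3 := by decide
  simp [flipEnds, move, mul_assoc, h]

theorem flipEnds_move_two (c : Flag τ) : flipEnds (K.move 2 c) = K.move 2 (flipEnds c) := by
  have h : Equiv.swap (0 : Fin 4) 1 3 = 3 := by decide
  simp [flipEnds, move, mul_assoc, h]

theorem turnVal_one_eq (x : Module.Dual ℤ (J2 τ)) (c : Flag τ) :
    turnVal x c 1 = orient c * (2 * x (basisVec c.1 (Sum.inl (flagEdge c)))) := by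
  have h : c.2 0 ≠ c.2 1 := fun h => absurd (c.2.injective h) (by decide)
  simp [turnVal, edgeVal, h, flagEdge]

/-- The value of a linear form on `J²` at the face of a flag, with the orientation sign. -/
def sideVal (x : Module.Dual ℤ (J2 τ)) (c : Flag τ) : ℤ := orient c * faceVal x c.1 (c.2 3)

/-- The edge `ji` gives `C*` at the end `i` and `C` at the end `j`, with opposite orientation signs;
only face values remain. -/
theorem turnVal_flipEnds (x : Module.Dual ℤ (J2 τ)) (c : Flag τ) :
    turnVal x c 0 + turnVal x (flipEnds c) 1 = sideVal x c - sideVal x (K.move 1 c) := by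
  have ho := K.orient_move 1 c
  simp [turnVal, orient_flipEnds, sideVal, ho]
  simp [flipEnds, move]
  ring

theorem sideVal_move_two {x : Module.Dual ℤ (J2 τ)} (hx : x ∈ LinearMap.ker K.F.dualMap)
    (c : Flag τ) : sideVal x (K.move 2 c) = sideVal x c := by
  have h := K.faceVal_move_two hx c.1 (c.2 3)
  have ho := K.orient_move 2 c
  simp only [sideVal, ho]
  simp [move, h]

/-- For `C` this is the edge condition. For `C*`, passing to the other end of the edge reduces to
`C`, up to side values that telescope. -/
theorem sum_turnVal_corner {x : Module.Dual ℤ (J2 τ)} (hx : x ∈ LinearMap.ker K.F.dualMap)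
    (n : ℕ) (w : ℕ → Flag τ) (hw : ∀ a < n, w (a + 1) = K.move 2 (K.move 1 (w a)))
    (hn : w n = w 0) : ∑ a ∈ Finset.range n, turnVal x (w a) = 0 := by
  have one : ∀ w : ℕ → Flag τ, (∀ a < n, w (a + 1) = K.move 2 (K.move 1 (w a))) →
      w n = w 0 → ∑ a ∈ Finset.range n, turnVal x (w a) 1 = 0 := by
    intro w hw hn
    have ho : ∀ a ≤ n, orient (w a) = orient (w 0) := by
      intro a
      induction a with
      | zero => intro _; rfl
      | succ a ih => intro ha; rw [hw a ha, orient_move, orient_move, neg_neg, ih (by omega)]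
    have e := K.sum_edge_eq_zero hx n w hw hn
    calc _ = ∑ a ∈ Finset.range n,
          orient (w 0) * (2 * x (basisVec (w a).1 (Sum.inl (flagEdge (w a))))) :=
          Finset.sum_congr rfl fun a ha => by
            rw [turnVal_one_eq, ho a (Finset.mem_range.1 ha).le]
      _ = 0 := by rw [← Finset.mul_sum, ← Finset.mul_sum, e]; simp
  funext j
  rw [Finset.sum_apply]
  fin_cases j
  · have e1 := one (fun a => flipEnds (w a))
      (fun a ha => by rw [hw a ha, flipEnds_move_two, flipEnds_move_one]) (by rw [hn])
    have e2 : ∀ a ∈ Finset.range n, turnVal x (w a) 0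
        = (sideVal x (w a) - sideVal x (w (a + 1))) - turnVal x (flipEnds (w a)) 1 := by
      intro a ha
      rw [hw a (Finset.mem_range.1 ha), K.sideVal_move_two hx, ← K.turnVal_flipEnds]
      ring
    change ∑ a ∈ Finset.range n, turnVal x (w a) 0 = 0
    rw [Finset.sum_congr rfl e2, Finset.sum_sub_distrib, e1,
      Finset.sum_range_sub' (fun a => sideVal x (w a)), hn]
    simp
  · exact one w hw hn

/-- A decoration defines a cocycle. -/
theorem exists_cocycle_turnVal [Fintype τ] {x : Module.Dual ℤ (J2 τ)}
    (hx : x ∈ K.decorationModule) :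
    ∃ ξ ∈ K.Z1, ∀ c, ξ 0 c - ξ 0 (K.move 1 c) = turnVal x c :=
  K.exists_cocycle _ (K.turnVal_move_one x) (K.turnVal_triangle hx.1)
    (K.sum_turnVal_corner hx.2)

/-! ## The cup product of the cocycles of two decorations -/

section Cup

theorem cocycle_move_one {ξ : FlagFun τ} (hξ : ξ ∈ K.Z1) (c : Flag τ) :
    ξ 2 (K.move 1 c) = ξ 2 c + (ξ 0 c - ξ 0 (K.move 1 c)) := by
  have h1 := hξ.2 c
  have h2 := hξ.2 (K.move 1 c)
  rw [hξ.1 1] at h2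
  rw [← sub_eq_zero, ← sub_eq_zero.2 (h2.trans h1.symm)]
  abel

variable [Fintype τ]

theorem sum_move (a : Fin 3) (f : Flag τ → ℤ) : ∑ c, f (K.move a c) = ∑ c, f c :=
  Equiv.sum_comp (K.movePerm a) f

theorem sum_flipEnds (f : Flag τ → ℤ) : ∑ c, f (flipEnds c) = ∑ c, f c :=
  Equiv.sum_comp (Function.Involutive.toPerm flipEnds flipEnds_flipEnds) f

theorem sum_orient_move (a : Fin 3) (f : Flag τ → ℤ) :
    ∑ c, orient c * f (K.move a c) = - ∑ c, orient c * f c := by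
  rw [← K.sum_move a (fun c => orient c * f c), ← Finset.sum_neg_distrib]
  exact Finset.sum_congr rfl fun c _ => by rw [orient_move]; ring

theorem sum_orient_flipEnds (f : Flag τ → ℤ) :
    ∑ c, orient c * f (flipEnds c) = - ∑ c, orient c * f c := by
  rw [← sum_flipEnds (fun c => orient c * f c), ← Finset.sum_neg_distrib]
  exact Finset.sum_congr rfl fun c _ => by rw [orient_flipEnds]; ring

/-- The cup product as a sum of local terms. -/
theorem two_threeCup {x y : Module.Dual ℤ (J2 τ)} (hx : x ∈ LinearMap.ker K.F.dualMap)
    (hy : y ∈ LinearMap.ker K.F.dualMap) {ξ η : FlagFun τ} (hξ : ξ ∈ K.Z1) (hη : η ∈ K.Z1)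
    (n : ℤ) (h : ∀ c, ξ 0 c - ξ 0 (K.move 1 c) = turnVal x c)
    (k : ∀ c, η 0 c - η 0 (K.move 1 c) = n • turnVal y c) :
    2 * threeCup ξ η = ∑ c, orient c *
      (- (turnVal x c 0 * (2 * (η 0 c 0 + η 0 (flipEnds c) 1)
          + (η 0 c 1 + η 0 (flipEnds c) 0) - n * sideVal y c))
        + 2 * (sideVal x c * (2 * η 0 (flipEnds c) 1 + η 0 (flipEnds c) 0))) := by
  -- `q` collects the parts of `ξ 2` at both ends of an edge, corrected so as to be invariant under
  -- `move 1` and `move 2`. `D` is invariant under `move 1`, and `Z` is a potential around the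
  -- corner for the variation of `G`.
  let q : Flag τ → ℤ := fun c => ξ 2 c 0 + ξ 2 (flipEnds c) 1 + sideVal x c
  let D : Flag τ → ℤ := fun c => 2 * (η 0 c 0 + η 0 (flipEnds c) 1)
    + (η 0 c 1 + η 0 (flipEnds c) 0) - n * sideVal y c
  let G : Flag τ → ℤ := fun c => 2 * η 0 (flipEnds c) 1 + η 0 (flipEnds c) 0
  let Z : Flag τ → ℤ := fun c => 2 * η 2 (flipEnds c) 1 + η 2 (flipEnds c) 0
  have ξ1 : ∀ c j, ξ 2 (K.move 1 c) j = ξ 2 c j + turnVal x c j := fun c j => by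
    have := congrFun (K.cocycle_move_one hξ c) j
    rwa [h] at this
  have η1 : ∀ c j, η 2 (K.move 1 c) j = η 2 c j + n * turnVal y c j := fun c j => by
    have := congrFun (K.cocycle_move_one hη c) j
    rwa [k] at this
  have k' : ∀ c j, η 0 (K.move 1 c) j = η 0 c j - n * turnVal y c j := fun c j => by
    have := congrFun (k c) j
    simp only [Pi.sub_apply, Pi.smul_apply, smul_eq_mul] at this
    linarith
  have q1 : ∀ c, q (K.move 1 c) = q c := fun c => by
    simp only [q, flipEnds_move_one, ξ1]
    linear_combination K.turnVal_flipEnds x c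
  have q2 : ∀ c, q (K.move 2 c) = q c := fun c => by
    simp only [q, flipEnds_move_two, hξ.1 2, K.sideVal_move_two hx]
  have Z2 : ∀ c, Z (K.move 2 c) = Z c := fun c => by
    simp only [Z, flipEnds_move_two, hη.1 2]
  have D1 : ∀ c, D (K.move 1 c) = D c := fun c => by
    have e1 := K.turnVal_flipEnds y c
    have e2 := K.turnVal_flipEnds y (flipEnds c)
    have e3 : sideVal y (flipEnds c) = - sideVal y c := by
      have s : Equiv.swap (0 : Fin 4) 1 3 = 3 := by decide
      simp only [sideVal, orient_flipEnds]
      simp [flipEnds, s]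
    have e4 : sideVal y (flipEnds (K.move 1 c)) = - sideVal y (K.move 1 c) := by
      have s : Equiv.swap (0 : Fin 4) 1 3 = 3 := by decide
      simp only [sideVal, orient_flipEnds]
      simp [flipEnds, s]
    rw [flipEnds_flipEnds, e3, ← flipEnds_move_one, e4] at e2
    simp only [D, flipEnds_move_one, k']
    linear_combination -2 * n * e1 - n * e2
  have G1 : ∀ c, n * (2 * turnVal y (flipEnds c) 1 + turnVal y (flipEnds c) 0)
      = G c - G (K.move 1 c) := fun c => by
    simp only [G, flipEnds_move_one, k']; ring
  have Z1 : ∀ c, Z (K.move 1 c) = Z c + (G c - G (K.move 1 c)) := fun c => by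
    rw [← G1]
    simp only [Z, flipEnds_move_one, η1]; ring
  have S1 : threeCup ξ η = ∑ c, orient c * (ξ 2 c 0 * (2 * η 0 c 0 + η 0 c 1))
      - ∑ c, orient c * (ξ 2 (flipEnds c) 1 * G c) := by
    have e : ∑ c, orient c * (ξ 2 (flipEnds c) 1 * G c)
        = - ∑ c, orient c * (ξ 2 c 1 * (2 * η 0 c 1 + η 0 c 0)) :=
      sum_orient_flipEnds fun c => ξ 2 c 1 * (2 * η 0 c 1 + η 0 c 0)
    rw [e, sub_neg_eq_add, ← Finset.sum_add_distrib]
    refine Finset.sum_congr rfl fun c _ => ?_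
    simp only [threeDualKilling, LinearMap.mk₂_apply]
    ring
  have S2 : ∑ c, orient c * (ξ 2 c 0 * sideVal y c) = 0 :=
    K.sum_orient_eq_zero 2 _ fun c => by rw [hξ.1 2, K.sideVal_move_two hy]
  -- From here to `S5`: since `q` is constant around edges and the variation of `G` is that of `Z`,
  -- twice the signed sum of `q * G` is zero.
  have S3 : ∑ c, orient c * (q c * Z c) = 0 :=
    K.sum_orient_eq_zero 2 _ fun c => by rw [q2, Z2]
  have S4 : ∑ c, orient c * (q c * (Z c + (G c - G (K.move 1 c)))) = 0 := by
    have e := K.sum_orient_move 1 fun c => q c * Z c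
    simp only [q1, Z1] at e
    rw [e, S3, neg_zero]
  have S5 : ∑ c, orient c * (q c * G (K.move 1 c)) = - ∑ c, orient c * (q c * G c) := by
    have e := K.sum_orient_move 1 fun c => q c * G c
    simpa only [q1] using e
  -- Averaging over `move 1` eliminates `ξ 2`: twice the signed sum of `ξ 2 c 0 * D c` is minus that
  -- of `turnVal x c 0 * D c`.
  have S6 : ∑ c, orient c * ((ξ 2 c 0 + turnVal x c 0) * D c)
      = - ∑ c, orient c * (ξ 2 c 0 * D c) := by
    have e := K.sum_orient_move 1 fun c => ξ 2 c 0 * D c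
    simpa only [ξ1, D1] using e
  simp only [mul_add, add_mul, mul_sub, Finset.sum_add_distrib, Finset.sum_sub_distrib] at S4 S6
  have S7 : ∑ c, orient c * (ξ 2 c 0 * (2 * η 0 c 0 + η 0 c 1))
      - ∑ c, orient c * (ξ 2 (flipEnds c) 1 * G c)
      = ∑ c, orient c * (ξ 2 c 0 * D c) + n * ∑ c, orient c * (ξ 2 c 0 * sideVal y c)
        + ∑ c, orient c * (sideVal x c * G c) - ∑ c, orient c * (q c * G c) := by
    simp only [Finset.mul_sum, ← Finset.sum_add_distrib, ← Finset.sum_sub_distrib]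
    refine Finset.sum_congr rfl fun c _ => ?_
    simp only [q, D, G]
    ring
  have S8 : ∑ c, orient c * (- (turnVal x c 0 * D c) + 2 * (sideVal x c * G c))
      = - ∑ c, orient c * (turnVal x c 0 * D c) + 2 * ∑ c, orient c * (sideVal x c * G c) := by
    rw [Finset.mul_sum, ← Finset.sum_neg_distrib, ← Finset.sum_add_distrib]
    exact Finset.sum_congr rfl fun c _ => by ring
  refine Eq.trans ?_ S8.symm
  rw [S1, S7, S2]
  linarith

theorem OmegaStar_eq (x y : Module.Dual ℤ (J2 τ)) :
    OmegaStar τ x y = ∑ t : τ, ∑ i : Fin 4,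
      (edgeVal x t (edgeA i).1.1 (edgeA i).1.2 * edgeVal y t (edgeB i).1.1 (edgeB i).1.2
        - edgeVal x t (edgeB i).1.1 (edgeB i).1.2 * edgeVal y t (edgeA i).1.1 (edgeA i).1.2) := by
  have e : ∀ (x : Module.Dual ℤ (J2 τ)) (t : τ) (e : TetEdge),
      edgeVal x t e.1.1 e.1.2 = x (basisVec t (Sum.inl e)) := fun x t e => dif_pos e.2
  simp only [e]
  rfl

/-- The pullback of the Weil-Petersson form by twice the boundary holonomy. -/
theorem threeCup_eq {x y : Module.Dual ℤ (J2 τ)} (hx : x ∈ K.decorationModule)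
    (hy : y ∈ K.decorationModule) {ξ η : FlagFun τ} (hξ : ξ ∈ K.Z1) (hη : η ∈ K.Z1)
    (h : ∀ c, ξ 0 c - ξ 0 (K.move 1 c) = turnVal x c)
    (k : ∀ c, η 0 c - η 0 (K.move 1 c) = turnVal y c) :
    threeCup ξ η = 12 * OmegaStar τ x y := by
  -- `T` sums `η 0` over the three sides of a triangle. Subtracting its coboundary from `3 • η`
  -- gives a cocycle with zero sum over these sides, so that `θ 0` is local in `y`; the factor 3
  -- avoids dividing.
  let T : Flag τ → Fin 2 → ℤ := fun c => η 0 c + η 0 (K.move 1 c) + η 0 (K.move 1 (K.move 0 c))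
  have T0 : ∀ c, T (K.move 0 c) = T c := fun c => by
    simp only [T, move_move, hη.1 0]; abel
  have T1 : ∀ c, T (K.move 1 c) = T c := fun c => by
    simp only [T, move_move]
    rw [← move_braid, hη.1 0]; abel
  have hg : (![0, 0, T] : FlagFun τ) ∈ K.C0 := by
    intro a b hb c
    fin_cases a
    · rfl
    · rfl
    · fin_cases b
      · exact T0 c
      · exact T1 c
      · exact absurd rfl hb
  let θ : FlagFun τ := (3 : ℤ) • η - d0 ![0, 0, T]
  have hθ : θ ∈ K.Z1 := K.Z1.sub_mem (K.Z1.smul_mem _ hη) (K.d0_mem_Z1 hg)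
  have θ0 : ∀ c, θ 0 c = (3 : ℤ) • η 0 c - T c := fun c => by
    change (3 : ℤ) • η 0 c - (T c - 0) = _
    rw [sub_zero]
  have θ1 : ∀ c, θ 0 c = turnVal y c + turnVal y (K.move 0 c) := fun c => by
    rw [θ0, ← k, ← k, hη.1 0]
    simp only [T]
    rw [show (3 : ℤ) = 1 + 1 + 1 by norm_num, add_smul, add_smul, one_smul]
    abel
  have hk : ∀ c, θ 0 c - θ 0 (K.move 1 c) = (3 : ℤ) • turnVal y c := fun c => by
    rw [θ0, θ0, T1, ← k, smul_sub]; abel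
  have e1 : threeCup ξ θ = 3 * threeCup ξ η := by
    rw [map_sub, map_smul, K.threeCup_coboundary_right hξ hg, sub_zero, smul_eq_mul]
  have e2 := K.two_threeCup hx.2 hy.2 hξ hθ 3 h hk
  -- Each product carries one orientation sign from `x` and one from `y`; they cancel, and
  -- `localTerm` is what remains.
  have e3 : ∀ c : Flag τ, orient c *
      (- (turnVal x c 0 * (2 * (θ 0 c 0 + θ 0 (flipEnds c) 1)
          + (θ 0 c 1 + θ 0 (flipEnds c) 0) - 3 * sideVal y c))
        + 2 * (sideVal x c * (2 * θ 0 (flipEnds c) 1 + θ 0 (flipEnds c) 0)))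
      = orient c * localTerm (edgeVal x c.1) (edgeVal y c.1) (faceVal x c.1) (faceVal y c.1)
          (c.2 0) (c.2 1) (c.2 2) (c.2 3) := fun c => by
    have a1 : Equiv.swap (1 : Fin 4) 2 0 = 0 := by decide
    have a2 : Equiv.swap (1 : Fin 4) 2 3 = 3 := by decide
    have a3 : Equiv.swap (0 : Fin 4) 1 2 = 2 := by decide
    have a4 : Equiv.swap (0 : Fin 4) 1 3 = 3 := by decide
    have o1 := K.orient_move 0 c
    have o2 := K.orient_move 0 (flipEnds c)
    rw [orient_flipEnds, neg_neg] at o2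
    simp only [θ1, Pi.add_apply, turnVal, o1, o2, orient_flipEnds, sideVal, Matrix.cons_val_zero,
      Matrix.cons_val_one]
    have p1 : (K.move 0 c).1 = c.1 := rfl
    have p2 : (flipEnds c).1 = c.1 := rfl
    have p3 : (K.move 0 (flipEnds c)).1 = c.1 := rfl
    have q0 : (K.move 0 c).2 0 = c.2 0 := by simp [move, a1]
    have q1 : (K.move 0 c).2 1 = c.2 2 := by simp [move]
    have q2 : (K.move 0 c).2 2 = c.2 1 := by simp [move]
    have q3 : (K.move 0 c).2 3 = c.2 3 := by simp [move, a2]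
    have r0 : (flipEnds c).2 0 = c.2 1 := by simp [flipEnds]
    have r1 : (flipEnds c).2 1 = c.2 0 := by simp [flipEnds]
    have r2 : (flipEnds c).2 2 = c.2 2 := by simp [flipEnds, a3]
    have r3 : (flipEnds c).2 3 = c.2 3 := by simp [flipEnds, a4]
    have s0 : (K.move 0 (flipEnds c)).2 0 = c.2 1 := by simp [move, flipEnds, a1]
    have s1 : (K.move 0 (flipEnds c)).2 1 = c.2 2 := by simp [move, flipEnds, a3]
    have s2 : (K.move 0 (flipEnds c)).2 2 = c.2 0 := by simp [move, flipEnds]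
    have s3 : (K.move 0 (flipEnds c)).2 3 = c.2 3 := by simp [move, flipEnds, a2, a4]
    simp only [p1, p2, p3, q0, q1, q2, q3, r0, r1, r2, r3, s0, s1, s2, s3, localTerm]
    rcases orient_eq c with e | e <;> rw [e] <;> ring
  rw [Finset.sum_congr rfl fun c _ => e3 c, Fintype.sum_prod_type] at e2
  have e4 : ∀ t : τ, _ := fun t => sum_localTerm (edgeVal x t) (edgeVal y t) (faceVal x t)
    (faceVal y t) (sum_edgeVal hx.1 t) (sum_edgeVal hy.1 t) (edgeVal_of_eq x t)
    (edgeVal_of_eq y t) (faceVal_eq hx.1 t) (faceVal_eq hy.1 t)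
  have e5 := e2.trans (Finset.sum_congr rfl fun t _ => e4 t)
  rw [← Finset.mul_sum, ← OmegaStar_eq, e1] at e5
  linarith

end Cup

end ClosedComplex

/-! ## Division by two -/

section DivTwo

variable {A V W : Type*} [AddCommGroup A] [AddCommGroup V] [AddCommGroup W]

theorem two_mul_smul_tmul_oneHalf (n : ℤ) (y : A) (r : ZHalf) :
    ((2 * n) • y) ⊗ₜ[ℤ] (oneHalf * r) = (n • y) ⊗ₜ[ℤ] r := by
  rw [mul_smul, TensorProduct.smul_tmul, two_smul, ← two_mul, ← mul_assoc,
    two_mul_oneHalf, one_mul]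

variable (A) in
/-- Half of the map `(A ⊗ V)[1/2] → (A ⊗ W)[1/2]` induced by a linear map `V → W`. -/
def halfOf (f : V →ₗ[ℤ] W) : Half (A ⊗[ℤ] V) →ₗ[ℤ] Half (A ⊗[ℤ] W) :=
  TensorProduct.map (f.lTensor A) (LinearMap.mulLeft ℤ oneHalf)

theorem halfOf_tmul (f : V →ₗ[ℤ] W) (x : A) (v : V) (r : ZHalf) :
    halfOf A f ((x ⊗ₜ v) ⊗ₜ r) = (x ⊗ₜ f v) ⊗ₜ (oneHalf * r) := rfl

theorem applyForm_halfOf (f : V →ₗ[ℤ] W) (φ : W →ₗ[ℤ] ℤ) (ψ : V →ₗ[ℤ] ℤ)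
    (h : ∀ v, φ (f v) = 2 * ψ v) (z : Half (A ⊗[ℤ] V)) :
    applyForm A φ (halfOf A f z) = applyForm A ψ z := by
  induction z using half_tensor_induction with
  | tmul x v r =>
    rw [halfOf_tmul, applyForm_tmul, applyForm_tmul, h, two_mul_smul_tmul_oneHalf]
  | add z z' h h' => rw [map_add, map_add, map_add, h, h']

theorem wedgeFormHalf_tmul (B : LinearMap.BilinForm ℤ V) (x y : A) (v w : V) (r s : ZHalf) :
    wedgeFormHalf A B ((x ⊗ₜ v) ⊗ₜ r) ((y ⊗ₜ w) ⊗ₜ s) = (B v w • wedge A x y) ⊗ₜ (r * s) := by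
  rw [← wedgeForm_tmul]
  rfl

/-- The factor 4 is absorbed by the two scalars `1/2`, one in each argument. -/
theorem wedgeFormHalf_halfOf (f : V →ₗ[ℤ] W) (B : LinearMap.BilinForm ℤ V)
    (C : LinearMap.BilinForm ℤ W) (n : ℤ) (h : ∀ v w, C (f v) (f w) = 2 * (2 * (n * B v w)))
    (z z' : Half (A ⊗[ℤ] V)) :
    wedgeFormHalf A C (halfOf A f z) (halfOf A f z') = n • wedgeFormHalf A B z z' := by
  induction z using half_tensor_induction with
  | add z w h h' => simp only [map_add, LinearMap.add_apply, smul_add, h, h']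
  | tmul x v r =>
    induction z' using half_tensor_induction with
    | add z w h h' => simp only [map_add, smul_add, h, h']
    | tmul y w s =>
      rw [halfOf_tmul, halfOf_tmul, wedgeFormHalf_tmul, wedgeFormHalf_tmul, h, mul_mul_mul_comm,
        mul_assoc, two_mul_smul_tmul_oneHalf, two_mul_smul_tmul_oneHalf, mul_smul,
        TensorProduct.smul_tmul']

end DivTwo

namespace ClosedComplex

variable {τ : Type*} (K : ClosedComplex τ)

/-! ## The boundary holonomy map -/

/-- On a turn, `turnVal` exceeds twice the `C*` exponent by the values of the two faces crossed. The
side left by a turn and the side entered by the next are glued, so their face values cancel along a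
loop. For `C` there is no correction. -/
theorem sum_turnVal_loop {K : ClosedComplex τ} {x : Module.Dual ℤ (J2 τ)}
    (hx : x ∈ LinearMap.ker K.F.dualMap) (γ : K.Loop) (a : Fin 2) :
    ∑ s ∈ Finset.range γ.length, turnVal x (γ.turn s) a
      = 2 * ∑ s ∈ Finset.range γ.length, x (turnVec (γ.turn s) a) := by
  have n0 : ∀ c : Flag τ, c.2 0 ≠ c.2 1 := fun c h => absurd (c.2.injective h) (by decide)
  have n1 : ∀ c : Flag τ, c.2 1 ≠ c.2 0 := fun c h => absurd (c.2.injective h) (by decide)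
  rw [Finset.mul_sum]
  fin_cases a
  · let f : Flag τ → ℤ := fun c => faceVal x c.1 (c.2 3)
    have hf : ∀ c, turnVal x c 0 = 2 * x (turnVec c 0) + (f c + f (K.move 1 c)) := fun c => by
      have e : f (K.move 1 c) = faceVal x c.1 (c.2 2) := by simp [f, move]
      rw [e]
      rcases Int.units_eq_one_or (Equiv.Perm.sign c.2) with h | h
      · simp [turnVal, turnVec, orient, h, edgeVal, n1, f]; ring
      · simp [turnVal, turnVec, orient, h, edgeVal, n1, f, faceVal]; ring
    have hs : ∀ s ∈ Finset.range γ.length, f (γ.turn (s + 1)) = - f (K.move 1 (γ.turn s)) := by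
      intro s hs
      have e : f (K.move 2 (K.move 1 (γ.turn s))) = - f (K.move 1 (γ.turn s)) :=
        K.faceVal_move_two hx _ _
      have e0 : ∀ c, f (K.move 0 c) = f c := fun c => by
        have : Equiv.swap (1 : Fin 4) 2 3 = 3 := by decide
        simp [f, move, this]
      rcases γ.step s (Finset.mem_range.1 hs) with h | h
      · rw [h, e]
      · rw [h, e0, e]
    have e : ∀ s ∈ Finset.range γ.length, turnVal x (γ.turn s) 0
        = 2 * x (turnVec (γ.turn s) 0) + (f (γ.turn s) - f (γ.turn (s + 1))) := fun s h => by
      rw [hf, hs s h, sub_neg_eq_add]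
    refine (Finset.sum_congr rfl e).trans ?_
    rw [Finset.sum_add_distrib, Finset.sum_range_sub' (fun s => f (γ.turn s)), γ.closed, sub_self,
      add_zero]
    rfl
  · refine Finset.sum_congr rfl fun s _ => ?_
    rcases Int.units_eq_one_or (Equiv.Perm.sign (γ.turn s).2) with h | h <;>
      simp [turnVal, turnVec, orient, h, edgeVal, n0]

theorem edgeVal_add (x y : Module.Dual ℤ (J2 τ)) (t : τ) (i j : Fin 4) :
    edgeVal (x + y) t i j = edgeVal x t i j + edgeVal y t i j := by
  unfold edgeVal; split_ifs <;> simp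

theorem edgeVal_smul (r : ℤ) (x : Module.Dual ℤ (J2 τ)) (t : τ) (i j : Fin 4) :
    edgeVal (r • x) t i j = r * edgeVal x t i j := by
  unfold edgeVal; split_ifs <;> simp

/-- The values on turns as a linear map. -/
def turnValLin : Module.Dual ℤ (J2 τ) →ₗ[ℤ] Flag τ → Fin 2 → ℤ where
  toFun x c := turnVal x c
  map_add' x y := by
    funext c a
    fin_cases a <;> simp [turnVal, edgeVal_add, faceVal] <;> ring
  map_smul' r x := by
    funext c a
    fin_cases a <;> simp [turnVal, edgeVal_smul, faceVal] <;> ring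

/-- The values of a cocycle on turns. -/
def turnOfCocycle : K.Z1 →ₗ[ℤ] Flag τ → Fin 2 → ℤ where
  toFun ξ c := (ξ : FlagFun τ) 0 c - (ξ : FlagFun τ) 0 (K.move 1 c)
  map_add' ξ η := by
    funext c a; simp; ring
  map_smul' r ξ := by
    funext c a; simp; ring

variable [Fintype τ]

/-- The decoration module is a subgroup of a free abelian group of finite rank, hence projective, so
the cocycles can be chosen linearly in the decoration. -/
theorem exists_cocycle_lift : ∃ f : K.decorationModule →ₗ[ℤ] K.Z1,
    ∀ x c, (f x : FlagFun τ) 0 c - (f x : FlagFun τ) 0 (K.move 1 c) = turnVal x.1 c := by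
  obtain ⟨f, hf⟩ := Module.projective_lifting_property K.turnOfCocycle.rangeRestrict
    ((turnValLin ∘ₗ K.decorationModule.subtype).codRestrict (LinearMap.range K.turnOfCocycle)
      fun x => by
        obtain ⟨ξ, hξ, h⟩ := K.exists_cocycle_turnVal x.2
        exact ⟨⟨ξ, hξ⟩, funext h⟩)
    K.turnOfCocycle.surjective_rangeRestrict
  refine ⟨f, fun x c => ?_⟩
  exact congrFun (congrArg Subtype.val (LinearMap.congr_fun hf x)) c

/-- A linear lift to cocycles of twice the boundary holonomy. -/
def cocycleLift : K.decorationModule →ₗ[ℤ] K.Z1 := K.exists_cocycle_lift.choose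

theorem cocycleLift_spec (x : K.decorationModule) (c : Flag τ) :
    (K.cocycleLift x : FlagFun τ) 0 c - (K.cocycleLift x : FlagFun τ) 0 (K.move 1 c)
      = turnVal x.1 c :=
  K.exists_cocycle_lift.choose_spec x c

/-- Twice the boundary holonomy of integral decorations. -/
def doubleHolonomy : K.decorationModule →ₗ[ℤ] K.H1 := K.toH1 ∘ₗ K.cocycleLift

theorem threeWP_doubleHolonomy (x y : K.decorationModule) :
    K.threeWP (K.doubleHolonomy x) (K.doubleHolonomy y) = 12 * K.omegaStar x y :=
  K.threeCup_eq x.2 y.2 (K.cocycleLift x).2 (K.cocycleLift y).2 (K.cocycleLift_spec x)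
    (K.cocycleLift_spec y)

theorem evalClass_doubleHolonomy {K : ClosedComplex τ} (γ : K.Loop) (n m : ℤ)
    (x : K.decorationModule) :
    evalClass γ ![n, m] (K.doubleHolonomy x)
      = 2 * (m * ∑ s ∈ Finset.range γ.length, x.1 (turnVec (γ.turn s) 1)
        + n * ∑ s ∈ Finset.range γ.length, x.1 (turnVec (γ.turn s) 0)) := by
  have e : ∀ a, evalCochain γ a (K.cocycleLift x : FlagFun τ)
      = 2 * ∑ s ∈ Finset.range γ.length, x.1 (turnVec (γ.turn s) a) := fun a => by
    rw [← sum_turnVal_loop x.2.2]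
    change ∑ s ∈ Finset.range γ.length, _ = _
    exact Finset.sum_congr rfl fun s _ => congrFun (K.cocycleLift_spec x (γ.turn s)) a
  change n * evalCochain γ 0 (K.cocycleLift x : FlagFun τ)
    + m * evalCochain γ 1 (K.cocycleLift x : FlagFun τ) = _
  rw [e, e]; ring

variable (k : Type*) [Field k]

/-- The boundary holonomy map. -/
def boundaryHolonomy : K.Decoration k →ₗ[ℤ] Half (Additive kˣ ⊗[ℤ] K.H1) :=
  halfOf (Additive kˣ) K.doubleHolonomy

/-- The holonomy of a loop for integral decorations, as a linear form. -/
def holonomyForm {K : ClosedComplex τ} (γ : K.Loop) (a : Fin 2) : K.decorationModule →ₗ[ℤ] ℤ :=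
  ∑ s ∈ Finset.range γ.length,
    Module.Dual.eval ℤ (J2 τ) (turnVec (γ.turn s) a) ∘ₗ K.decorationModule.subtype

theorem holonomy_eq {K : ClosedComplex τ} (γ : K.Loop) (a : Fin 2) (z : K.Decoration k) :
    holonomy k γ a z = applyForm (Additive kˣ) (holonomyForm γ a) z :=
  (applyForm_sum _ _ z).symm

theorem isBoundaryHolonomy_boundaryHolonomy :
    K.IsBoundaryHolonomy k (K.boundaryHolonomy k) := by
  intro z γ n m
  rw [holonomy_eq, holonomy_eq, ← applyForm_smul, ← applyForm_smul, ← applyForm_add]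
  refine applyForm_halfOf _ _ _ (fun x => ?_) z
  rw [evalClass_doubleHolonomy]
  simp [holonomyForm]

theorem eq_of_isBoundaryHolonomy {R R' : K.Decoration k →ₗ[ℤ] Half (Additive kˣ ⊗[ℤ] K.H1)}
    (h : K.IsBoundaryHolonomy k R) (h' : K.IsBoundaryHolonomy k R') : R = R' := by
  refine LinearMap.ext fun z => sub_eq_zero.1 (K.eq_zero_of_evalClass _ fun γ n m => ?_)
  rw [map_sub, h, h', sub_self]

theorem wedgeFormHalf_boundaryHolonomy (z z' : K.Decoration k) :
    (3 : ℤ) • wedgeFormHalf (Additive kˣ) K.omegaStar z z'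
      = wedgeFormHalf (Additive kˣ) K.threeWP (K.boundaryHolonomy k z)
          (K.boundaryHolonomy k z') := by
  refine (wedgeFormHalf_halfOf K.doubleHolonomy _ _ 3 (fun x y => ?_) z z').symm
  rw [threeWP_doubleHolonomy]; ring

end ClosedComplex

end FlagComplex

end

theorem corollary7p3 {τ : Type*} [Fintype τ] (K : FlagComplex.ClosedComplex τ)
    (hK : K.HasTorusLinks) (k : Type*) [Field k] :
    (∃! R : K.Decoration k →ₗ[ℤ] FlagComplex.Half (TensorProduct ℤ (Additive kˣ) K.H1),
      K.IsBoundaryHolonomy k R) ∧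
    ∀ R : K.Decoration k →ₗ[ℤ] FlagComplex.Half (TensorProduct ℤ (Additive kˣ) K.H1),
      K.IsBoundaryHolonomy k R →
        ∀ z z' : K.Decoration k,
          (3 : ℤ) • FlagComplex.wedgeFormHalf (Additive kˣ) K.omegaStar z z' =
            FlagComplex.wedgeFormHalf (Additive kˣ) K.threeWP (R z) (R z') := by
  refine ⟨⟨K.boundaryHolonomy k, K.isBoundaryHolonomy_boundaryHolonomy k, fun R hR =>
    K.eq_of_isBoundaryHolonomy k hR (K.isBoundaryHolonomy_boundaryHolonomy k)⟩,
    fun R hR z z' => ?_⟩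
  rw [K.eq_of_isBoundaryHolonomy k hR (K.isBoundaryHolonomy_boundaryHolonomy k)]
  exact K.wedgeFormHalf_boundaryHolonomy k z z'
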